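/- Let $n\ge 2$ and, for $d\ge 2$, let $\mathcal Q_n^d$ be the space of complex homogeneous polynomials (forms) of degree $d$ in $z_1,\dots,z_n$. Let $\Delta$ denote the discriminant on $\mathcal Q_n^d$: the irreducible polynomial in the coefficients of the forms, unique up to a nonzero constant factor, that generates the ideal of all polynomials in the coefficients vanishing on the hypersurface of those $Q\in\mathcal Q_n^d$ whose first-order partial derivatives have a common zero in $\mathbb C^n\setminus\{0\}$. For $m\ge 3$ put $X_n^m:=\{Q\in\mathcal Q_n^m:\Delta(Q)\ne 0\}$. For $Q\in X_n^m$ let $M(Q)=\mathbb C[z_1,\dots,z_n]/(\partial Q/\partial z_1,\dots,\partial Q/\partial z_n)$ be its Milnor algebra, $\mathfrak m\subset M(Q)$ the ideal of the elements represented by polynomials vanishing at $0$, and $\mathrm{Soc}(M(Q))=\{x\in\mathfrak m: x\,\mathfrak m=0\}$ its socle; the socle is one-dimensional over $\mathbb C$ and is spanned by the class $e_0$ of the Hessian $\det\left(\partial^2Q/\partial z_i\partial z_j\right)$. Let $\omega:\mathrm{Soc}(M(Q))\to\mathbb C$ be the linear isomorphism with $\omega(e_0)=1$, and let $e_j$ be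 the class of $z_j$ in $M(Q)$. The associated form of $Q$ is the form $\mathbf Q\in\mathcal Q_n^{n(m-2)}$ given by $$\mathbf Q(z)=\omega\left((z_1e_1+\dots+z_ne_n)^{n(m-2)}\right),\qquad z\in\mathbb C^n .$$ **Proposition.** For every pair $n,m$ with $n\ge 2$, $m\ge 3$, there exists $Q\in X_n^m$ such that $\Delta(\mathbf Q)\ne 0$. -/

import Mathlib

namespace AssocForm

open MvPolynomial

noncomputable section

/-- Exponents of the monomials of degree `d` in `n` variables: the coordinates on the space of
forms of degree `d` on `ℂ^n`. -/
abbrev FormIndex (n d : ℕ) : Type := {k : Fin n →₀ ℕ // k.degree = d}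

/-- The coefficient vector of a form of degree `d`. -/
def formCoeffs (n d : ℕ) (Q : MvPolynomial (Fin n) ℂ) : FormIndex n d → ℂ :=
  fun k => coeff k.1 Q

/-- The coefficient vectors of the forms of degree `d` on `ℂ^n` that are singular away from the
origin, i.e. whose first-order partial derivatives have a common zero other than `0`. -/
def singularLocus (n d : ℕ) : Set (FormIndex n d → ℂ) :=
  formCoeffs n d '' {Q | Q ∈ homogeneousSubmodule (Fin n) ℂ d ∧
    ∃ z : Fin n → ℂ, z ≠ 0 ∧ ∀ j, eval z (pderiv j Q) = 0}

/-- `D` is a greatest common divisor of all polynomials in the coefficients of forms of degree `d`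
on `ℂ^n` that vanish on the singular forms. For `n ≥ 2` and `d ≥ 2` the singular forms make up an
irreducible hypersurface, so that their vanishing ideal is principal, and `D` is then a generator
of it: the irreducible defining equation of this hypersurface, which is the classical
discriminant. It is determined up to a nonzero constant factor. -/
def IsDiscriminant (n d : ℕ) (D : MvPolynomial (FormIndex n d) ℂ) : Prop :=
  (∀ f ∈ vanishingIdeal ℂ (singularLocus n d), D ∣ f) ∧
    ∀ g, (∀ f ∈ vanishingIdeal ℂ (singularLocus n d), g ∣ f) → g ∣ D

instance formIndex_finite (n d : ℕ) : Finite (FormIndex n d) := by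
  have h : {k : Fin n →₀ ℕ | k.degree = d}.Finite :=
    (Finsupp.finite_of_degree_le d).subset fun k hk => le_of_eq hk
  exact h.to_subtype

theorem exists_isDiscriminant (n d : ℕ) : ∃ D, IsDiscriminant n d D := by
  classical
  obtain ⟨s, hs⟩ := IsNoetherian.noetherian (vanishingIdeal ℂ (singularLocus n d))
  let _ : StrongNormalizationMonoid (MvPolynomial (FormIndex n d) ℂ) :=
    UniqueFactorizationMonoid.strongNormalizationMonoid
  let _ := UniqueFactorizationMonoid.toNormalizedGCDMonoid (MvPolynomial (FormIndex n d) ℂ)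
  refine ⟨s.gcd id, fun f hf => ?_, fun g hg => ?_⟩
  · rw [← hs] at hf
    have hle : Submodule.span _ (s : Set (MvPolynomial (FormIndex n d) ℂ)) ≤
        Ideal.span {s.gcd id} :=
      Submodule.span_le.2 fun x hx => Ideal.mem_span_singleton.2 (Finset.gcd_dvd (f := id) hx)
    exact Ideal.mem_span_singleton.1 (hle hf)
  · exact Finset.dvd_gcd fun b hb => hg b (hs ▸ Submodule.subset_span hb)

/-- The discriminant polynomial of forms of degree `d` on `ℂ^n`. -/
def discriminantPoly (n d : ℕ) : MvPolynomial (FormIndex n d) ℂ :=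
  (exists_isDiscriminant n d).choose

/-- The value `Δ(Q)` of the discriminant at a form `Q` of degree `d` on `ℂ^n`. -/
def discriminant (n d : ℕ) (Q : MvPolynomial (Fin n) ℂ) : ℂ :=
  eval (formCoeffs n d Q) (discriminantPoly n d)

/-- The set `X_n^m` of forms of degree `m` on `ℂ^n` with nonzero discriminant. -/
def nondegenerateForms (n m : ℕ) : Set (MvPolynomial (Fin n) ℂ) :=
  {Q | Q ∈ homogeneousSubmodule (Fin n) ℂ m ∧ discriminant n m Q ≠ 0}

variable {n : ℕ}

/-- The Jacobian ideal `J(Q)`, generated by the first-order partial derivatives of `Q`. -/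
def jacobianIdeal (Q : MvPolynomial (Fin n) ℂ) : Ideal (MvPolynomial (Fin n) ℂ) :=
  Ideal.span (Set.range fun j => pderiv j Q)

/-- The Milnor algebra `M(Q) = ℂ[z_1, …, z_n] / J(Q)`. -/
abbrev MilnorAlgebra (Q : MvPolynomial (Fin n) ℂ) : Type :=
  MvPolynomial (Fin n) ℂ ⧸ jacobianIdeal Q

/-- The class in `M(Q)` of a polynomial. -/
abbrev milnorMk (Q : MvPolynomial (Fin n) ℂ) : MvPolynomial (Fin n) ℂ →ₐ[ℂ] MilnorAlgebra Q :=
  Ideal.Quotient.mkₐ ℂ (jacobianIdeal Q)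

/-- The ideal `𝔪` of `M(Q)` of all elements represented by polynomials vanishing at the origin. -/
def milnorMaximalIdeal (Q : MvPolynomial (Fin n) ℂ) : Ideal (MilnorAlgebra Q) :=
  Ideal.map (milnorMk Q) (RingHom.ker (eval (0 : Fin n → ℂ)))

/-- The socle `{x ∈ 𝔪 : x 𝔪 = 0}` of `M(Q)`. -/
def socle (Q : MvPolynomial (Fin n) ℂ) : Submodule ℂ (MilnorAlgebra Q) where
  carrier := {x | x ∈ milnorMaximalIdeal Q ∧ ∀ y ∈ milnorMaximalIdeal Q, x * y = 0}
  zero_mem' := ⟨zero_mem _, fun y _ => zero_mul y⟩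
  add_mem' := fun {a b} ha hb =>
    ⟨add_mem ha.1 hb.1, fun y hy => by rw [add_mul, ha.2 y hy, hb.2 y hy, add_zero]⟩
  smul_mem' := fun c x hx =>
    ⟨Submodule.smul_of_tower_mem _ c hx.1, fun y hy => by rw [smul_mul_assoc, hx.2 y hy, smul_zero]⟩

/-- The Hessian `Hess(Q)`: the determinant of the matrix of second-order partial derivatives. -/
def hessian (Q : MvPolynomial (Fin n) ℂ) : MvPolynomial (Fin n) ℂ :=
  (Matrix.of fun i j => pderiv i (pderiv j Q)).det

/-- `R` is the associated form of the form `Q` of degree `m` on `ℂ^n`: it is the form of degree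
`n(m-2)` given by `R(z) = ω((z_1 e_1 + ⋯ + z_n e_n)^{n(m-2)})`, where `e_j` is the class of `z_j` in
`M(Q)` and `ω : Soc(M(Q)) → ℂ` is the linear isomorphism that takes the value `1` at the class
`e_0` of the Hessian of `Q`. That the socle is one-dimensional, is spanned by `e_0` and contains
these powers is part of the assertion. There is at most one such `R`. -/
def IsAssociatedForm (m : ℕ) (Q R : MvPolynomial (Fin n) ℂ) : Prop :=
  R ∈ homogeneousSubmodule (Fin n) ℂ (n * (m - 2)) ∧
  ∃ (ω : socle Q ≃ₗ[ℂ] ℂ) (h₀ : milnorMk Q (hessian Q) ∈ socle Q),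
    ω ⟨milnorMk Q (hessian Q), h₀⟩ = 1 ∧
    ∀ z : Fin n → ℂ, ∃ hz : (∑ j, z j • milnorMk Q (X j)) ^ (n * (m - 2)) ∈ socle Q,
      eval z R = ω ⟨(∑ j, z j • milnorMk Q (X j)) ^ (n * (m - 2)), hz⟩

end

end AssocForm

namespace AssocForm

open MvPolynomial Filter Topology

noncomputable section

/-! Put `k = m - 2` and `e = k + 1`, and consider the pencil `Q_t = ∑ z_i^m - t (∑ z_i)^m`. Up to a
constant its partial derivatives are `z_j^e - h` with `h = t (∑ z_i)^e`, so modulo the Jacobian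
ideal all `z_j^e` agree, and a form is controlled by its values on the finite grid `μ_e^n`. If `h ≠
1` on the grid, the functional `q ↦ ∑_ζ (∏ ζ_i) q(ζ) / (1 - h(ζ))` kills the Jacobian ideal in
degree `nk` (`gridResidue_mul_sub`), the pairing it induces is nondegenerate
(`mem_of_gridResidue_eq_zero`), and it does not kill the Hessian (`gridResidue_hessian`). It is
therefore `ω` up to scale, and the associated form is a multiple of `∑_ζ (∏ ζ_i) (ζ·z)^{nk} / (1 - t
(∑ ζ_i)^e)` (`isAssociatedForm_pencilForm`).

Let `ρ ≠ 1` be an `e`-th root of unity nearest to `1`, and let `t` tend to `1/s` with `s = (n - 1 +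
ρ)^e`. After multiplication by `1 - ts` only the grid points with `(∑ ζ_i)^e = s` survive. These are
the multiples of the `n` points `ℓ_i` having one coordinate `ρ` and all others `1`
(`exists_eq_smul_nodePoint`), and the limit is `∑ c_i (ℓ_i·z)^{nk}` with all `c_i ≠ 0` and the `ℓ_i`
linearly independent. That is a Fermat form in other coordinates, hence nonsingular, and
nonsingularity is open, so some `t ≠ 1/s` works. The method needs `s ≠ 0`, which fails only for `n =
2`, `m = 3`; there `t = 0` gives a multiple of `z_1 z_2`.

Nonsingular forms have nonzero discriminant by an elimination argument: a determinant in the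
coefficients vanishes on all singular forms but not at the given form. -/

/-! ### Nonsingular forms and the discriminant -/

theorem homogeneousComponent_mem_span {σ : Type*} {s : Set (MvPolynomial σ ℂ)}
    (hs : ∀ p ∈ s, ∃ d, p.IsHomogeneous d) {p : MvPolynomial σ ℂ} (hp : p ∈ Ideal.span s) (N : ℕ) :
    homogeneousComponent N p ∈ Ideal.span s := by
  let _ := gradedAlgebra (σ := σ) (R := ℂ)
  exact homogeneousComponent_mem_of_mem (Ideal.homogeneous_span (homogeneousSubmodule σ ℂ) s
    fun x hx => by obtain ⟨d, hd⟩ := hs x hx; exact ⟨d, hd⟩) hp N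

theorem isHomogeneous_pderiv_of_mem {n d : ℕ} {Q : MvPolynomial (Fin n) ℂ}
    (hQ : Q ∈ homogeneousSubmodule (Fin n) ℂ d) (j : Fin n) :
    (pderiv j Q).IsHomogeneous (d - 1) :=
  ((mem_homogeneousSubmodule d Q).1 hQ).pderiv

theorem homogeneousComponent_mem_jacobianIdeal {n d : ℕ} {Q : MvPolynomial (Fin n) ℂ}
    (hQ : Q ∈ homogeneousSubmodule (Fin n) ℂ d) {p : MvPolynomial (Fin n) ℂ}
    (hp : p ∈ jacobianIdeal Q) (N : ℕ) : homogeneousComponent N p ∈ jacobianIdeal Q := by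
  refine homogeneousComponent_mem_span ?_ hp N
  rintro _ ⟨j, rfl⟩
  exact ⟨_, isHomogeneous_pderiv_of_mem hQ j⟩

theorem eval_eq_zero_of_mem_jacobianIdeal {n : ℕ} {Q p : MvPolynomial (Fin n) ℂ}
    (hp : p ∈ jacobianIdeal Q) {z : Fin n → ℂ} (hz : ∀ j, eval z (pderiv j Q) = 0) :
    eval z p = 0 := by
  have h : jacobianIdeal Q ≤ RingHom.ker (eval z) := by
    refine Ideal.span_le.2 ?_
    rintro _ ⟨j, rfl⟩
    exact hz j
  exact h hp

/-- By the Nullstellensatz, all monomials of some degree lie in the Jacobian ideal of a form that is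
nonsingular away from the origin. -/
theorem exists_monomial_mem_jacobianIdeal {n : ℕ} {F : MvPolynomial (Fin n) ℂ}
    (hF : ∀ z : Fin n → ℂ, (∀ j, eval z (pderiv j F) = 0) → z = 0) :
    ∃ N, ∀ a : Fin n →₀ ℕ, a.degree = N → monomial a 1 ∈ jacobianIdeal F := by
  have hX : ∀ i, ∃ K, (X i : MvPolynomial (Fin n) ℂ) ^ K ∈ jacobianIdeal F := by
    intro i
    have : (X i : MvPolynomial (Fin n) ℂ) ∈ (jacobianIdeal F).radical := by
      rw [← vanishingIdeal_zeroLocus_eq_radical (K := ℂ), mem_vanishingIdeal_iff]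
      intro x hx
      have : x = 0 := hF x fun j => by
        have := (mem_zeroLocus_iff.1 hx) (pderiv j F) (Ideal.subset_span ⟨j, rfl⟩)
        simpa [aeval_eq_eval] using this
      simp [this]
    exact this
  choose K hK using hX
  refine ⟨∑ i, K i + 1, fun a ha => ?_⟩
  obtain ⟨i, hi⟩ : ∃ i, K i ≤ a i := by
    by_contra! h
    have : a.degree ≤ ∑ i, K i := by
      rw [Finsupp.degree_eq_sum]
      exact Finset.sum_le_sum fun i _ => (h i).le
    omega
  have : (monomial a 1 : MvPolynomial (Fin n) ℂ) =
      monomial (a - Finsupp.single i (K i)) 1 * X i ^ K i := by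
    rw [X_pow_eq_monomial, monomial_mul, one_mul, tsub_add_cancel_of_le]
    rwa [Finsupp.single_le_iff]
  rw [this]
  exact Ideal.mul_mem_left _ _ (hK i)

theorem form_eq_sum_monomial {n d : ℕ} [Fintype (FormIndex n d)] {Q : MvPolynomial (Fin n) ℂ}
    (hQ : Q ∈ homogeneousSubmodule (Fin n) ℂ d) :
    Q = ∑ k : FormIndex n d, formCoeffs n d Q k • monomial k.1 (1 : ℂ) := by
  ext b
  simp only [coeff_sum, coeff_smul, coeff_monomial, formCoeffs, smul_eq_mul, mul_ite, mul_one,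
    mul_zero]
  by_cases hb : b.degree = d
  · rw [Finset.sum_eq_single ⟨b, hb⟩]
    · simp
    · intro k _ hk
      rw [if_neg]
      rintro rfl
      exact hk rfl
    · simp
  · rw [((mem_homogeneousSubmodule d Q).1 hQ).coeff_eq_zero hb, Finset.sum_eq_zero]
    intro k _
    rw [if_neg]
    rintro rfl
    exact hb k.2

theorem eval_eq_sum_formCoeffs {n d : ℕ} [Fintype (FormIndex n d)] {Q : MvPolynomial (Fin n) ℂ}
    (hQ : Q ∈ homogeneousSubmodule (Fin n) ℂ d) (z : Fin n → ℂ) :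
    eval z Q = ∑ k : FormIndex n d, formCoeffs n d Q k * eval z (monomial k.1 (1 : ℂ)) := by
  conv_lhs => rw [form_eq_sum_monomial hQ]
  simp [smul_eval]

/-- A form that is nonsingular away from the origin is not in the Zariski closure of the singular
forms. -/
theorem exists_mem_vanishingIdeal_eval_ne_zero {n d : ℕ} {F : MvPolynomial (Fin n) ℂ}
    (hFd : F ∈ homogeneousSubmodule (Fin n) ℂ d)
    (hF : ∀ z : Fin n → ℂ, (∀ j, eval z (pderiv j F) = 0) → z = 0) :
    ∃ f ∈ vanishingIdeal ℂ (singularLocus n d), eval (formCoeffs n d F) f ≠ 0 := by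
  classical
  obtain ⟨N, hN⟩ := exists_monomial_mem_jacobianIdeal hF
  have hg : ∀ a : FormIndex n N, ∃ g : Fin n → MvPolynomial (Fin n) ℂ,
      ∑ j, g j * pderiv j F = monomial a.1 1 := fun a =>
    Ideal.mem_span_range_iff_exists_fun.1 (hN a.1 a.2)
  choose g hg using hg
  let _ : Fintype (FormIndex n N) := Fintype.ofFinite _
  let _ : Fintype (FormIndex n d) := Fintype.ofFinite _
  -- The multipliers `g` are those found for `F` and stay fixed while the form varies, so the
  -- entries are linear in its coefficients and the matrix is the identity at `F`.
  let A : Matrix (FormIndex n N) (FormIndex n N) (MvPolynomial (FormIndex n d) ℂ) :=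
    Matrix.of fun a b => ∑ k : FormIndex n d,
      X k * C (coeff b.1 (∑ j, g a j * pderiv j (monomial k.1 1)))
  have hA : ∀ Q ∈ homogeneousSubmodule (Fin n) ℂ d, eval (formCoeffs n d Q) A.det =
      (Matrix.of fun a b : FormIndex n N => coeff b.1 (∑ j, g a j * pderiv j Q)).det := by
    intro Q hQ
    rw [RingHom.map_det]
    congr 1
    ext a b
    simp only [A, RingHom.mapMatrix_apply, Matrix.map_apply, Matrix.of_apply, map_sum, map_mul,
      eval_X, eval_C]
    conv_rhs => rw [form_eq_sum_monomial hQ]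
    simp only [map_sum, Derivation.map_smul, Finset.mul_sum, coeff_sum, mul_smul_comm, coeff_smul, smul_eq_mul]
    rw [Finset.sum_comm]
  refine ⟨A.det, mem_vanishingIdeal_iff.2 ?_, ?_⟩
  · rintro _ ⟨Q, ⟨hQ, z, hz, hsing⟩, rfl⟩
    rw [aeval_eq_eval]
    change eval _ A.det = 0
    rw [hA Q hQ, ← Matrix.exists_mulVec_eq_zero_iff]
    -- At a singular point `z` the vector of degree-`N` monomials is in the kernel: row `a`
    -- evaluates the degree-`N` component of an element of `J(Q)`, and that component is in `J(Q)`
    -- again.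
    refine ⟨fun b => eval z (monomial b.1 1), ?_, ?_⟩
    · obtain ⟨i, hi⟩ := Function.ne_iff.1 hz
      intro h
      have := congrFun h ⟨Finsupp.single i N, by simp⟩
      simp [eval_monomial] at this
      exact hi this.1
    · ext a
      have h1 : (∑ j, g a j * pderiv j Q) ∈ jacobianIdeal Q :=
        sum_mem fun j _ => Ideal.mul_mem_left _ _ (Ideal.subset_span ⟨j, rfl⟩)
      have h2 := eval_eq_zero_of_mem_jacobianIdeal
        (homogeneousComponent_mem_jacobianIdeal hQ h1 N) hsing
      rw [eval_eq_sum_formCoeffs (homogeneousComponent_mem N _)] at h2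
      rw [Pi.zero_apply, ← h2]
      simp only [Matrix.mulVec, dotProduct, Matrix.of_apply, formCoeffs, coeff_homogeneousComponent]
      exact Finset.sum_congr rfl fun b _ => by rw [if_pos b.2]
  · rw [hA F hFd]
    have : (Matrix.of fun a b : FormIndex n N => coeff b.1 (∑ j, g a j * pderiv j F)) = 1 := by
      ext a b
      simp [hg, coeff_monomial, Matrix.one_apply, Subtype.ext_iff]
    simp [this]

/-- The discriminant divides every polynomial that vanishes on the singular forms, so its vanishing
at `F` would force all of these to vanish there. -/
theorem discriminant_ne_zero {n d : ℕ} {F : MvPolynomial (Fin n) ℂ}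
    (hFd : F ∈ homogeneousSubmodule (Fin n) ℂ d)
    (hF : ∀ z : Fin n → ℂ, (∀ j, eval z (pderiv j F) = 0) → z = 0) : discriminant n d F ≠ 0 := by
  obtain ⟨f, hf, hne⟩ := exists_mem_vanishingIdeal_eval_ne_zero hFd hF
  obtain ⟨g, hg⟩ := (exists_isDiscriminant n d).choose_spec.1 f hf
  intro h
  apply hne
  rw [hg, map_mul]
  exact mul_eq_zero_of_left h _

/-- The points of `μ_e ^ n`, where `μ_e` is generated by `w`. -/
def gridPoint {n e : ℕ} (w : ℂ) (c : Fin n → Fin e) : Fin n → ℂ := fun i => w ^ (c i : ℕ)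

/-! ### Fourier analysis on `μ_e^n` -/

section Grid

variable {n e : ℕ} {w : ℂ}

theorem gridPoint_pow (hw : IsPrimitiveRoot w e) (c : Fin n → Fin e) (i : Fin n) :
    gridPoint w c i ^ e = 1 := by
  rw [gridPoint, ← pow_mul, mul_comm, pow_mul, hw.pow_eq_one, one_pow]

theorem gridPoint_pow_of_dvd (hw : IsPrimitiveRoot w e) (c : Fin n → Fin e) (i : Fin n) {b : ℕ}
    (hb : e ∣ b) : gridPoint w c i ^ b = 1 := by
  obtain ⟨q, rfl⟩ := hb
  rw [pow_mul, gridPoint_pow hw, one_pow]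

theorem exists_gridPoint_eq [NeZero e] (hw : IsPrimitiveRoot w e) {v : Fin n → ℂ}
    (hv : ∀ i, v i ^ e = 1) : ∃ c : Fin n → Fin e, gridPoint w c = v := by
  have : ∀ i, ∃ j < e, w ^ j = v i := fun i => hw.eq_pow_of_pow_eq_one (hv i)
  choose j hj hjv using this
  exact ⟨fun i => ⟨j i, hj i⟩, funext hjv⟩

theorem sum_root_pow [NeZero e] (hw : IsPrimitiveRoot w e) (b : ℕ) :
    ∑ j : Fin e, (w ^ (j : ℕ)) ^ b = if e ∣ b then (e : ℂ) else 0 := by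
  have h1 : ∀ j : Fin e, (w ^ (j : ℕ)) ^ b = (w ^ b) ^ (j : ℕ) := fun j => by
    rw [← pow_mul, ← pow_mul, mul_comm]
  simp only [h1]
  rw [Fin.sum_univ_eq_sum_range (fun j => (w ^ b) ^ j)]
  split_ifs with h
  · rw [(hw.pow_eq_one_iff_dvd b).2 h]
    simp
  · have hne : w ^ b ≠ 1 := fun h' => h ((hw.pow_eq_one_iff_dvd b).1 h')
    rw [geom_sum_eq hne, ← pow_mul, mul_comm, pow_mul, hw.pow_eq_one]
    simp

theorem sum_gridPoint_prod_pow [NeZero e] (hw : IsPrimitiveRoot w e) (b : Fin n → ℕ) :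
    ∑ c : Fin n → Fin e, ∏ i, gridPoint w c i ^ b i =
      if ∀ i, e ∣ b i then (e : ℂ) ^ n else 0 := by
  have h := Finset.prod_univ_sum (fun _ : Fin n => (Finset.univ : Finset (Fin e)))
    (fun i j => (w ^ (j : ℕ)) ^ b i)
  rw [Fintype.piFinset_univ] at h
  simp only [gridPoint]
  rw [← h]
  simp only [sum_root_pow hw]
  split_ifs with hb
  · simp [hb]
  · push Not at hb
    obtain ⟨i, hi⟩ := hb
    exact Finset.prod_eq_zero (Finset.mem_univ i) (if_neg hi)

/-- The Fourier coefficients of a function on `μ_e ^ n`. -/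
def gridFourier (w : ℂ) (g : (Fin n → Fin e) → ℂ) (r : Fin n → Fin e) : ℂ :=
  ((e : ℂ) ^ n)⁻¹ * ∑ c, g c * ∏ i, gridPoint w c i ^ (e - (r i : ℕ))

theorem gridFourier_prod_pow [NeZero e] (hw : IsPrimitiveRoot w e) (b : Fin n → ℕ)
    (r : Fin n → Fin e) :
    gridFourier w (fun c => ∏ i, gridPoint w c i ^ b i) r =
      if ∀ i, (r i : ℕ) = b i % e then 1 else 0 := by
  have he : (e : ℂ) ^ n ≠ 0 := pow_ne_zero _ (NeZero.ne _)
  simp only [gridFourier, ← Finset.prod_mul_distrib, ← pow_add]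
  rw [sum_gridPoint_prod_pow hw]
  have : ∀ i, e ∣ b i + (e - (r i : ℕ)) ↔ (r i : ℕ) = b i % e := by
    intro i
    have hr := (r i).2
    have e1 : b i + (e - (r i : ℕ)) = b i % e + (e - (r i : ℕ)) + e * (b i / e) := by
      have := Nat.mod_add_div (b i) e
      omega
    rw [e1, Nat.dvd_add_left (dvd_mul_right _ _)]
    have hb := Nat.mod_lt (b i) hr.pos
    -- The number `b i % e + (e - r i)` lies strictly between `0` and `2e`, so `e` is the only
    -- multiple of `e` it can be.
    constructor
    · rintro ⟨q, hq⟩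
      have h1 : 0 < q := by
        rcases Nat.eq_zero_or_pos q with rfl | h
        · omega
        · exact h
      have h2 : q < 2 := by
        by_contra h2
        have : e * 2 ≤ e * q := Nat.mul_le_mul_left _ (by omega)
        omega
      obtain rfl : q = 1 := by omega
      omega
    · intro h
      rw [← h]
      exact ⟨1, by omega⟩
  simp only [this]
  split_ifs
  · exact inv_mul_cancel₀ he
  · simp

theorem sum_pow_mul_pow [NeZero e] (hw : IsPrimitiveRoot w e) (a b : Fin e) :
    ∑ j : Fin e, (w ^ (a : ℕ)) ^ (e - (j : ℕ)) * (w ^ (b : ℕ)) ^ (j : ℕ) =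
      if a = b then (e : ℂ) else 0 := by
  have hp : ∀ a : Fin e, (w ^ (a : ℕ)) ^ e = 1 := fun a => by
    rw [← pow_mul, mul_comm, pow_mul, hw.pow_eq_one, one_pow]
  split_ifs with h
  · subst h
    have : ∀ j : Fin e, (w ^ (a : ℕ)) ^ (e - (j : ℕ)) * (w ^ (a : ℕ)) ^ (j : ℕ) = 1 := fun j => by
      rw [← pow_add, Nat.sub_add_cancel j.2.le, hp]
    simp [this]
  · have hne : w ^ (b : ℕ) - w ^ (a : ℕ) ≠ 0 := fun h' =>
      h (Fin.ext (hw.pow_inj a.2 b.2 (sub_eq_zero.1 h').symm))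
    have hg := geom_sum₂_mul (w ^ (b : ℕ)) (w ^ (a : ℕ)) e
    rw [hp, hp, sub_self, mul_eq_zero, or_iff_left hne] at hg
    rw [← mul_zero (w ^ (a : ℕ)), ← hg, Fin.sum_univ_eq_sum_range
      (fun j => (w ^ (a : ℕ)) ^ (e - j) * (w ^ (b : ℕ)) ^ j), Finset.mul_sum]
    refine Finset.sum_congr rfl fun j hj => ?_
    have : e - j = e - 1 - j + 1 := by
      have := Finset.mem_range.1 hj
      omega
    rw [this, pow_succ]
    ring

theorem gridFourier_inversion [NeZero e] (hw : IsPrimitiveRoot w e) (g : (Fin n → Fin e) → ℂ)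
    (c : Fin n → Fin e) :
    ∑ r, gridFourier w g r * ∏ i, gridPoint w c i ^ (r i : ℕ) = g c := by
  have he : (e : ℂ) ^ n ≠ 0 := pow_ne_zero _ (NeZero.ne _)
  have key : ∀ c' : Fin n → Fin e, ∑ r : Fin n → Fin e,
      (∏ i, gridPoint w c' i ^ (e - (r i : ℕ))) * ∏ i, gridPoint w c i ^ (r i : ℕ) =
      if c' = c then (e : ℂ) ^ n else 0 := by
    intro c'
    have h := Finset.prod_univ_sum (fun _ : Fin n => (Finset.univ : Finset (Fin e)))
      (fun i j => (w ^ (c' i : ℕ)) ^ (e - (j : ℕ)) * (w ^ (c i : ℕ)) ^ (j : ℕ))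
    rw [Fintype.piFinset_univ] at h
    simp only [gridPoint, ← Finset.prod_mul_distrib]
    rw [← h]
    simp only [sum_pow_mul_pow hw]
    split_ifs with hc
    · simp [hc]
    · obtain ⟨i, hi⟩ := Function.ne_iff.1 hc
      exact Finset.prod_eq_zero (Finset.mem_univ i) (if_neg hi)
  simp only [gridFourier, mul_assoc, Finset.sum_mul]
  rw [← Finset.mul_sum, Finset.sum_comm]
  simp only [← Finset.mul_sum, key]
  simp only [mul_ite, mul_zero, Finset.sum_ite_eq', Finset.mem_univ, if_true]
  field_simp

theorem gridFourier_sum {ι : Type*} (s : Finset ι) (a : ι → ℂ) (g : ι → (Fin n → Fin e) → ℂ)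
    (r : Fin n → Fin e) :
    gridFourier w (fun c => ∑ k ∈ s, a k * g k c) r = ∑ k ∈ s, a k * gridFourier w (g k) r := by
  simp only [gridFourier, Finset.sum_mul, Finset.mul_sum]
  rw [Finset.sum_comm]
  refine Finset.sum_congr rfl fun k _ => Finset.sum_congr rfl fun c _ => ?_
  ring

theorem gridPoint_add_one [NeZero e] (hw : IsPrimitiveRoot w e) (c : Fin n → Fin e) :
    gridPoint w (c + 1) = w • gridPoint w c := by
  ext i
  simp only [gridPoint, Pi.add_apply, Pi.one_apply, Fin.val_add, Pi.smul_apply, smul_eq_mul]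
  have h1 : ((1 : Fin e) : ℕ) = 1 % e := rfl
  rw [h1, Nat.add_mod_mod, ← pow_succ']
  exact (pow_eq_pow_mod _ hw.pow_eq_one).symm

/-- The Fourier coefficients of a function of weight `D` under the diagonal action of `μ_e` vanish
outside the congruence class of `D`. -/
theorem dvd_of_gridFourier_ne_zero [NeZero e] (hw : IsPrimitiveRoot w e)
    {g : (Fin n → Fin e) → ℂ} {D : ℕ} (hg : ∀ c, g (c + 1) = w ^ D * g c) {r : Fin n → Fin e}
    (hr : gridFourier w g r ≠ 0) : e ∣ D + ∑ i, (e - (r i : ℕ)) := by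
  rw [← hw.pow_eq_one_iff_dvd]
  -- Reindex by `c ↦ c + 1`, which multiplies the grid point by `w`.
  have h : gridFourier w g r = w ^ (D + ∑ i, (e - (r i : ℕ))) * gridFourier w g r := by
    have h1 := Equiv.sum_comp (Equiv.addRight (1 : Fin n → Fin e))
      (fun c => g c * ∏ i, gridPoint w c i ^ (e - (r i : ℕ)))
    simp only [Equiv.coe_addRight, hg, gridPoint_add_one hw, Pi.smul_apply, smul_eq_mul, mul_pow,
      Finset.prod_mul_distrib, Finset.prod_pow_eq_pow_sum] at h1
    rw [gridFourier, mul_left_comm]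
    refine congrArg _ ?_
    rw [Finset.mul_sum, ← h1]
    refine Finset.sum_congr rfl fun c _ => ?_
    rw [pow_add]
    ring
  exact (mul_eq_right₀ hr).1 h.symm

end Grid

/-! ### The residue pairing -/

section Duality

variable {n e : ℕ} {w : ℂ}

/-- The normal form of a form `x` of degree `D` modulo the ideal generated by the differences
`X i ^ e - X i₀ ^ e`. -/
def gridReduction (e : ℕ) (w : ℂ) (i₀ : Fin n) (D : ℕ) (x : MvPolynomial (Fin n) ℂ) :
    MvPolynomial (Fin n) ℂ :=
  ∑ r : Fin n → Fin e, C (gridFourier w (fun c => eval (gridPoint w c) x) r) *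
    ((∏ i, X i ^ (r i : ℕ)) * X i₀ ^ (D - ∑ i, (r i : ℕ)))

theorem sub_gridReduction_mem [NeZero e] (hw : IsPrimitiveRoot w e) {i₀ : Fin n}
    {I : Ideal (MvPolynomial (Fin n) ℂ)} (hI : ∀ i, X i ^ e - X i₀ ^ e ∈ I)
    {x : MvPolynomial (Fin n) ℂ} {D : ℕ} (hx : x.IsHomogeneous D) :
    x - gridReduction e w i₀ D x ∈ I := by
  classical
  -- Modulo `I` every factor `X i ^ e` may be traded for `X i₀ ^ e`, so only the residues of the
  -- exponents matter and the excess degree goes to `i₀`.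
  have hmod : ∀ b : Fin n →₀ ℕ, b.degree = D → (∏ i, X i ^ b i : MvPolynomial (Fin n) ℂ) -
      (∏ i, X i ^ (b i % e)) * X i₀ ^ (D - ∑ i, b i % e) ∈ I := by
    intro b hb
    rw [← Ideal.Quotient.eq]
    have h1 : ∀ i, Ideal.Quotient.mk I (X i) ^ e = Ideal.Quotient.mk I (X i₀) ^ e := fun i => by
      rw [← map_pow, ← map_pow]
      exact Ideal.Quotient.eq.2 (hI i)
    have h2 : ∀ i, Ideal.Quotient.mk I (X i) ^ b i = Ideal.Quotient.mk I (X i) ^ (b i % e) *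
        Ideal.Quotient.mk I (X i₀) ^ (e * (b i / e)) := fun i => by
      conv_lhs => rw [← Nat.mod_add_div (b i) e, pow_add, pow_mul, h1, ← pow_mul]
    have h3 : D - ∑ i, b i % e = ∑ i, e * (b i / e) := by
      rw [← hb, Finsupp.degree_eq_sum, Nat.sub_eq_iff_eq_add, ← Finset.sum_add_distrib]
      · exact Finset.sum_congr rfl fun i _ => (Nat.div_add_mod (b i) e).symm
      · exact Finset.sum_le_sum fun i _ => Nat.mod_le _ _
    simp only [map_mul, map_prod, map_pow, h2, h3]
    rw [Finset.prod_mul_distrib, Finset.prod_pow_eq_pow_sum]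
  have hF : ∀ r : Fin n → Fin e, gridFourier w (fun c => eval (gridPoint w c) x) r =
      ∑ b ∈ x.support, coeff b x * if ∀ i, (r i : ℕ) = b i % e then 1 else 0 := by
    intro r
    simp only [eval_eq' _ x]
    rw [gridFourier_sum]
    simp only [gridFourier_prod_pow hw]
  have hred : gridReduction e w i₀ D x = ∑ b ∈ x.support, C (coeff b x) *
      ((∏ i, X i ^ (b i % e)) * X i₀ ^ (D - ∑ i, b i % e)) := by
    simp only [gridReduction, hF, map_sum, Finset.sum_mul]
    rw [Finset.sum_comm]
    refine Finset.sum_congr rfl fun b _ => ?_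
    rw [Finset.sum_eq_single fun i => ⟨b i % e, Nat.mod_lt _ (NeZero.pos e)⟩]
    · simp
    · intro r _ hr
      rw [if_neg]
      · simp
      · exact fun h => hr (funext fun i => Fin.ext (h i))
    · simp
  rw [hred]
  nth_rw 1 [x.as_sum]
  rw [← Finset.sum_sub_distrib]
  refine sum_mem fun b hb => ?_
  have hbD : b.degree = D := by
    by_contra h
    exact (mem_support_iff.1 hb) (hx.coeff_eq_zero h)
  rw [monomial_eq, Finsupp.prod_fintype _ _ (fun i => pow_zero _), ← mul_sub]
  exact Ideal.mul_mem_left _ _ (hmod b hbD)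

/-- For a fixed degree the normal form is built from the grid values alone. -/
theorem sub_mem_of_eval_gridPoint_eq [NeZero e] (hw : IsPrimitiveRoot w e) {i₀ : Fin n}
    {I : Ideal (MvPolynomial (Fin n) ℂ)} (hI : ∀ i, X i ^ e - X i₀ ^ e ∈ I)
    {x y : MvPolynomial (Fin n) ℂ} {D : ℕ} (hx : x.IsHomogeneous D) (hy : y.IsHomogeneous D)
    (hxy : ∀ c : Fin n → Fin e, eval (gridPoint w c) x = eval (gridPoint w c) y) : x - y ∈ I := by
  have h1 := sub_gridReduction_mem hw hI hx
  have h2 := sub_gridReduction_mem hw hI hy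
  have h3 : gridReduction e w i₀ D x = gridReduction e w i₀ D y := by
    simp only [gridReduction, hxy]
  rw [h3] at h1
  simpa using sub_mem h1 h2

/-- The residue functional `q ↦ ∑ (∏ ζ_i) q(ζ) / (1 - h(ζ))`, where `ζ` ranges over `μ_e ^ n`. -/
def gridResidue (e : ℕ) (w : ℂ) (h : MvPolynomial (Fin n) ℂ) :
    MvPolynomial (Fin n) ℂ →ₗ[ℂ] ℂ where
  toFun q := ∑ c : Fin n → Fin e, (∏ i, gridPoint w c i) * (1 - eval (gridPoint w c) h)⁻¹ *
    eval (gridPoint w c) q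
  map_add' p q := by simp [mul_add, Finset.sum_add_distrib]
  map_smul' a q := by
    simp only [smul_eval, RingHom.id_apply, smul_eq_mul, Finset.mul_sum]
    exact Finset.sum_congr rfl fun c _ => by ring

theorem gridResidue_apply (h q : MvPolynomial (Fin n) ℂ) :
    gridResidue e w h q = ∑ c : Fin n → Fin e, (∏ i, gridPoint w c i) *
      (1 - eval (gridPoint w c) h)⁻¹ * eval (gridPoint w c) q := rfl

/-- On the grid `X i ^ e - h` equals `1 - h` and cancels the denominator. What remains is a
character sum with exponents `b i + 1`, nonzero only if each is divisible by `e`, which the degree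
bound excludes. -/
theorem gridResidue_mul_sub [NeZero e] (hw : IsPrimitiveRoot w e) {h : MvPolynomial (Fin n) ℂ}
    (hh : ∀ c : Fin n → Fin e, 1 - eval (gridPoint w c) h ≠ 0) (b : Fin n →₀ ℕ)
    (hb : b.degree < n * (e - 1)) (i : Fin n) :
    gridResidue e w h (monomial b 1 * (X i ^ e - h)) = 0 := by
  have h1 : ∀ c : Fin n → Fin e, (∏ i, gridPoint w c i) * (1 - eval (gridPoint w c) h)⁻¹ *
      eval (gridPoint w c) (monomial b 1 * (X i ^ e - h)) =
      ∏ i, gridPoint w c i ^ (b i + 1) := by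
    intro c
    have h0 := hh c
    have h2 : eval (gridPoint w c) (monomial b (1 : ℂ)) = ∏ i, gridPoint w c i ^ b i := by
      rw [eval_monomial, one_mul, Finsupp.prod_fintype _ _ (fun i => pow_zero _)]
    simp only [map_mul, map_sub, map_pow, eval_X, gridPoint_pow hw, pow_succ,
      Finset.prod_mul_distrib, h2]
    field_simp
  rw [gridResidue_apply]
  simp only [h1]
  rw [sum_gridPoint_prod_pow hw, if_neg]
  intro hd
  have : n * (e - 1) ≤ b.degree := by
    rw [Finsupp.degree_eq_sum]
    calc n * (e - 1) = ∑ i : Fin n, (e - 1) := by simp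
      _ ≤ ∑ i, b i := Finset.sum_le_sum fun i _ => by
        have := Nat.le_of_dvd (by omega) (hd i)
        omega
  omega

/-- Nondegeneracy of the residue pairing modulo the ideal of the forms `X i ^ e - h`. -/
theorem mem_of_gridResidue_eq_zero [NeZero e] (hw : IsPrimitiveRoot w e)
    {h : MvPolynomial (Fin n) ℂ} (he : h.IsHomogeneous e) (i₀ : Fin n)
    (hh : ∀ c : Fin n → Fin e, 1 - eval (gridPoint w c) h ≠ 0)
    {I : Ideal (MvPolynomial (Fin n) ℂ)} (hI : ∀ i, X i ^ e - h ∈ I)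
    {x : MvPolynomial (Fin n) ℂ} {D : ℕ} (hx : x.IsHomogeneous D)
    (h0 : ∀ b : Fin n →₀ ℕ, D + b.degree = n * (e - 1) →
      gridResidue e w h (x * monomial b 1) = 0) : x ∈ I := by
  have hI' : ∀ i, X i ^ e - X i₀ ^ e ∈ I := fun i => by simpa using sub_mem (hI i) (hI i₀)
  have hscale : ∀ {q : MvPolynomial (Fin n) ℂ} {d : ℕ}, q.IsHomogeneous d →
      ∀ c : Fin n → Fin e, eval (gridPoint w (c + 1)) q = w ^ d * eval (gridPoint w c) q := by
    intro q d hq c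
    rw [gridPoint_add_one hw, eval_eq', eval_eq', Finset.mul_sum]
    refine Finset.sum_congr rfl fun b hb => ?_
    have hbD : ∑ i, b i = d := by
      by_contra hne
      rw [← Finsupp.degree_eq_sum] at hne
      exact (mem_support_iff.1 hb) (hq.coeff_eq_zero hne)
    simp only [Pi.smul_apply, smul_eq_mul, mul_pow, Finset.prod_mul_distrib,
      Finset.prod_pow_eq_pow_sum, hbD]
    ring
  -- Since `X i₀ ^ e - h` takes the value `1 - h` on the grid, `g` is what a quotient of `x` by it
  -- would have to be there. The aim is to lift `g` to a form of degree `D - e`.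
  set g : (Fin n → Fin e) → ℂ := fun c =>
    (1 - eval (gridPoint w c) h)⁻¹ * eval (gridPoint w c) x with hgdef
  have hg : ∀ c, g (c + 1) = w ^ D * g c := fun c => by
    simp only [hgdef, hscale hx, hscale he, hw.pow_eq_one, one_mul]
    ring
  -- Homogeneity forces `∑ r i ≡ D` mod `e`. The residue hypothesis kills the coefficients with `∑ r
  -- i ≥ D`, leaving exactly those whose monomials fit in degree `D - e`.
  have hsupp : ∀ r : Fin n → Fin e, gridFourier w g r ≠ 0 →
      ∃ j, D = ∑ i, (r i : ℕ) + e * (j + 1) := by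
    intro r hr
    obtain ⟨q, hq⟩ := dvd_of_gridFourier_ne_zero hw hg hr
    have hsum : ∑ i, (e - (r i : ℕ)) + ∑ i, (r i : ℕ) = e * n := by
      rw [← Finset.sum_add_distrib]
      simp [Nat.sub_add_cancel (Fin.is_le' (n := e)), mul_comm]
    rcases Nat.lt_or_ge n q with hqn | hqn
    · obtain ⟨j, rfl⟩ := Nat.exists_eq_add_of_lt hqn
      exact ⟨j, by rw [mul_add, mul_add] at hq; rw [mul_add]; omega⟩
    · exfalso
      apply hr
      obtain ⟨s, hs⟩ := Nat.exists_eq_add_of_le hqn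
      have hes : e * n = e * q + e * s := by rw [hs, mul_add]
      -- The factor `∏ ζ_i` in the residue supplies one power of each coordinate, so exponents `e -
      -- 1 - r i` extract the Fourier coefficient. The power of `X i₀` is `1` on the grid and only
      -- adjusts the degree.
      let b : Fin n →₀ ℕ := Finsupp.equivFunOnFinite.symm (fun i => e - 1 - (r i : ℕ)) +
        Finsupp.single i₀ (e * s)
      have hb1 : ∑ i, (e - 1 - (r i : ℕ)) + ∑ i, (r i : ℕ) = n * (e - 1) := by
        rw [← Finset.sum_add_distrib, Finset.sum_congr rfl fun i _ =>
          Nat.sub_add_cancel (Nat.le_sub_one_of_lt (r i).2)]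
        simp
      have hb2 : ∑ i, (e - (r i : ℕ)) = ∑ i, (e - 1 - (r i : ℕ)) + n := by
        rw [Finset.sum_congr rfl fun i _ => show e - (r i : ℕ) = (e - 1 - (r i : ℕ)) + 1 by
          have := (r i).2
          omega, Finset.sum_add_distrib]
        simp
      have hbdeg : b.degree = ∑ i, (e - 1 - (r i : ℕ)) + e * s := by
        rw [map_add, Finsupp.degree_single, Finsupp.degree_eq_sum]
        rfl
      have h1 := h0 b (by rw [hbdeg]; omega)
      rw [gridResidue_apply] at h1
      rw [gridFourier, ← mul_zero ((e : ℂ) ^ n)⁻¹, ← h1]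
      congr 1
      refine Finset.sum_congr rfl fun c _ => ?_
      have h2 : eval (gridPoint w c) (monomial b (1 : ℂ)) =
          ∏ i, gridPoint w c i ^ (e - 1 - (r i : ℕ)) := by
        have : monomial b (1 : ℂ) = monomial (Finsupp.equivFunOnFinite.symm
            (fun i => e - 1 - (r i : ℕ))) 1 * X i₀ ^ (e * s) := by
          rw [X_pow_eq_monomial, monomial_mul, one_mul]
        rw [this, map_mul, map_pow, eval_X, gridPoint_pow_of_dvd hw c i₀ (dvd_mul_right _ _),
          mul_one, eval_monomial, one_mul, Finsupp.prod_fintype _ _ (fun i => pow_zero _)]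
        simp
      have h3 : ∏ i, gridPoint w c i ^ (e - (r i : ℕ)) =
          (∏ i, gridPoint w c i) * ∏ i, gridPoint w c i ^ (e - 1 - (r i : ℕ)) := by
        rw [← Finset.prod_mul_distrib]
        refine Finset.prod_congr rfl fun i _ => ?_
        rw [← pow_succ']
        congr 1
        have := (r i).2
        omega
      rw [map_mul, h2, h3]
      simp only [hgdef]
      ring
  set y : MvPolynomial (Fin n) ℂ := ∑ r : Fin n → Fin e, C (gridFourier w g r) *
    ((∏ i, X i ^ (r i : ℕ)) * X i₀ ^ (D - e - ∑ i, (r i : ℕ))) * (X i₀ ^ e - h) with hy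
  have hyI : y ∈ I := sum_mem fun r _ => Ideal.mul_mem_left _ _ (hI i₀)
  have hyD : y.IsHomogeneous D := by
    refine IsHomogeneous.sum _ _ _ fun r _ => ?_
    by_cases hr : gridFourier w g r = 0
    · rw [hr]
      simpa using isHomogeneous_zero _ _ _
    obtain ⟨j, hj⟩ := hsupp r hr
    have hD : 0 + (∑ i, (r i : ℕ) + (D - e - ∑ i, (r i : ℕ))) + e = D := by
      rw [mul_add] at hj
      omega
    have h1 : ((X i₀ : MvPolynomial (Fin n) ℂ) ^ e - h).IsHomogeneous e :=
      (isHomogeneous_X_pow i₀ e).sub he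
    have h2 : (∏ i, X i ^ (r i : ℕ) : MvPolynomial (Fin n) ℂ).IsHomogeneous (∑ i, (r i : ℕ)) :=
      IsHomogeneous.prod _ _ _ fun i _ => isHomogeneous_X_pow i _
    have := ((isHomogeneous_C (Fin n) (gridFourier w g r)).mul
      (h2.mul (isHomogeneous_X_pow i₀ (D - e - ∑ i, (r i : ℕ))))).mul h1
    rwa [hD] at this
  have hxy : ∀ c : Fin n → Fin e, eval (gridPoint w c) x = eval (gridPoint w c) y := by
    intro c
    have h1 : ∀ r : Fin n → Fin e, eval (gridPoint w c) (C (gridFourier w g r) *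
        ((∏ i, X i ^ (r i : ℕ)) * X i₀ ^ (D - e - ∑ i, (r i : ℕ))) * (X i₀ ^ e - h)) =
        gridFourier w g r * (∏ i, gridPoint w c i ^ (r i : ℕ)) * (1 - eval (gridPoint w c) h) := by
      intro r
      by_cases hr : gridFourier w g r = 0
      · simp [hr]
      obtain ⟨j, hj⟩ := hsupp r hr
      have hD : D - e - ∑ i, (r i : ℕ) = e * j := by
        rw [mul_add] at hj
        omega
      simp only [hD, map_mul, map_prod, map_pow, map_sub, eval_C, eval_X, gridPoint_pow hw,
        gridPoint_pow_of_dvd hw c i₀ (dvd_mul_right e j), mul_one]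
    rw [hy, map_sum]
    simp only [h1]
    rw [← Finset.sum_mul, gridFourier_inversion hw]
    have := hh c
    simp only [hgdef]
    field_simp
  simpa using add_mem (sub_mem_of_eval_gridPoint_eq hw hI' hx hyD hxy) hyI

end Duality

/-! ### The Milnor algebra of the pencil -/

section Milnor

variable {n k : ℕ} {w : ℂ}

/-- The form `∑ X i ^ (k + 2) - t (∑ X i) ^ (k + 2)`. -/
def pencilForm (n k : ℕ) (t : ℂ) : MvPolynomial (Fin n) ℂ :=
  ∑ i, X i ^ (k + 2) - C t * (∑ i, X i) ^ (k + 2)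

/-- The form `t (∑ X i) ^ (k + 1)`. -/
def sumPowForm (n k : ℕ) (t : ℂ) : MvPolynomial (Fin n) ℂ :=
  C t * (∑ i, X i) ^ (k + 1)

theorem isHomogeneous_sum_X (n : ℕ) : (∑ i, X i : MvPolynomial (Fin n) ℂ).IsHomogeneous 1 :=
  IsHomogeneous.sum _ _ _ fun i _ => isHomogeneous_X ℂ i

theorem isHomogeneous_pencilForm (n k : ℕ) (t : ℂ) : (pencilForm n k t).IsHomogeneous (k + 2) := by
  refine IsHomogeneous.sub (IsHomogeneous.sum _ _ _ fun i _ => isHomogeneous_X_pow i _) ?_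
  have := (isHomogeneous_C (Fin n) t).mul ((isHomogeneous_sum_X n).pow (k + 2))
  rwa [zero_add, one_mul] at this

theorem isHomogeneous_sumPowForm (n k : ℕ) (t : ℂ) :
    (sumPowForm n k t).IsHomogeneous (k + 1) := by
  have := (isHomogeneous_C (Fin n) t).mul ((isHomogeneous_sum_X n).pow (k + 1))
  rwa [zero_add, one_mul] at this

theorem pderiv_sum_X (j : Fin n) : pderiv j (∑ i, X i : MvPolynomial (Fin n) ℂ) = 1 := by
  simp [pderiv_X, Pi.single_apply]

theorem pderiv_pencilForm (t : ℂ) (j : Fin n) :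
    pderiv j (pencilForm n k t) = C ((k : ℂ) + 2) * (X j ^ (k + 1) - sumPowForm n k t) := by
  have h1 : pderiv j (∑ i, X i ^ (k + 2) : MvPolynomial (Fin n) ℂ) =
      C ((k : ℂ) + 2) * X j ^ (k + 1) := by
    rw [map_sum, Finset.sum_eq_single j]
    · simp only [pderiv_pow, pderiv_X_self, mul_one, map_add, map_natCast, map_ofNat]
      push_cast
      rfl
    · intro i _ hi
      simp [pderiv_X_of_ne hi]
    · simp
  rw [pencilForm, map_sub, h1, pderiv_C_mul, pderiv_pow, pderiv_sum_X, sumPowForm]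
  push_cast
  simp only [map_add, map_natCast, map_ofNat]
  ring

theorem pderiv_pderiv_pencilForm (t : ℂ) (i j : Fin n) :
    pderiv i (pderiv j (pencilForm n k t)) = C (((k : ℂ) + 2) * (k + 1)) *
      ((if i = j then X j ^ k else 0) - C t * (∑ i, X i) ^ k) := by
  have h1 : pderiv i (X j ^ (k + 1) : MvPolynomial (Fin n) ℂ) =
      C ((k : ℂ) + 1) * if i = j then X j ^ k else 0 := by
    split_ifs with h
    · subst h
      simp
    · simp [pderiv_X_of_ne (Ne.symm h)]
  rw [pderiv_pencilForm, pderiv_C_mul, map_sub, h1, sumPowForm, pderiv_C_mul, pderiv_pow,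
    pderiv_sum_X]
  simp only [Nat.add_one_sub_one, map_add, map_mul, map_natCast, map_ofNat, map_one]
  push_cast
  ring

theorem X_pow_sub_mem_jacobianIdeal (t : ℂ) (j : Fin n) :
    X j ^ (k + 1) - sumPowForm n k t ∈ jacobianIdeal (pencilForm n k t) := by
  have h : pderiv j (pencilForm n k t) ∈ jacobianIdeal (pencilForm n k t) :=
    Ideal.subset_span ⟨j, rfl⟩
  rw [pderiv_pencilForm] at h
  have h2 := Ideal.mul_mem_left _ (C ((k : ℂ) + 2)⁻¹) h
  have hk : (k : ℂ) + 2 ≠ 0 := by exact_mod_cast (by omega : k + 2 ≠ 0)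
  rwa [← mul_assoc, ← C_mul, inv_mul_cancel₀ hk, C_1, one_mul] at h2

/-- The extension of the residue functional from forms of degree `n * k` to all polynomials by zero
on the other homogeneous components. -/
def topResidue (k : ℕ) (w : ℂ) (h : MvPolynomial (Fin n) ℂ) : MvPolynomial (Fin n) ℂ →ₗ[ℂ] ℂ :=
  gridResidue (k + 1) w h ∘ₗ homogeneousComponent (n * k)

theorem topResidue_of_isHomogeneous {h q : MvPolynomial (Fin n) ℂ} (hq : q.IsHomogeneous (n * k)) :
    topResidue k w h q = gridResidue (k + 1) w h q := by
  rw [topResidue, LinearMap.comp_apply,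
    homogeneousComponent_of_mem ((mem_homogeneousSubmodule _ _).2 hq), if_pos rfl]

variable {t : ℂ}

theorem topResidue_eq_zero_of_mem (hw : IsPrimitiveRoot w (k + 1))
    (ht : ∀ c : Fin n → Fin (k + 1), 1 - eval (gridPoint w c) (sumPowForm n k t) ≠ 0)
    {p : MvPolynomial (Fin n) ℂ} (hp : p ∈ jacobianIdeal (pencilForm n k t)) :
    topResidue k w (sumPowForm n k t) p = 0 := by
  obtain ⟨g, rfl⟩ := Ideal.mem_span_range_iff_exists_fun.1 hp
  rw [map_sum]
  refine Finset.sum_eq_zero fun j _ => ?_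
  rw [pderiv_pencilForm, mul_left_comm, ← smul_eq_C_mul, map_smul, (g j).as_sum, Finset.sum_mul,
    map_sum]
  refine smul_eq_zero_of_right _ (Finset.sum_eq_zero fun b _ => ?_)
  have h1 : (monomial b (coeff b (g j)) : MvPolynomial (Fin n) ℂ) =
      coeff b (g j) • monomial b 1 := by simp [smul_monomial]
  rw [h1, smul_mul_assoc, map_smul]
  refine smul_eq_zero_of_right _ ?_
  have h2 : (monomial b (1 : ℂ) * (X j ^ (k + 1) - sumPowForm n k t)).IsHomogeneous
      (b.degree + (k + 1)) :=
    (isHomogeneous_monomial _ rfl).mul ((isHomogeneous_X_pow j _).sub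
      (isHomogeneous_sumPowForm n k t))
  rw [topResidue, LinearMap.comp_apply,
    homogeneousComponent_of_mem ((mem_homogeneousSubmodule _ _).2 h2)]
  split_ifs with h
  · refine gridResidue_mul_sub hw ht b ?_ j
    rw [Nat.add_sub_cancel]
    omega
  · rw [map_zero]

/-- Above degree `nk` there are no complementary monomials, so the nondegeneracy criterion holds
vacuously. -/
theorem mem_jacobianIdeal_of_lt (hw : IsPrimitiveRoot w (k + 1)) (i₀ : Fin n)
    (ht : ∀ c : Fin n → Fin (k + 1), 1 - eval (gridPoint w c) (sumPowForm n k t) ≠ 0)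
    {x : MvPolynomial (Fin n) ℂ} {D : ℕ} (hx : x.IsHomogeneous D) (hD : n * k < D) :
    x ∈ jacobianIdeal (pencilForm n k t) := by
  refine mem_of_gridResidue_eq_zero hw (isHomogeneous_sumPowForm n k t) i₀ ht
    (X_pow_sub_mem_jacobianIdeal t) hx fun b hb => ?_
  rw [Nat.add_sub_cancel] at hb
  omega

theorem mul_mem_jacobianIdeal (hw : IsPrimitiveRoot w (k + 1)) (i₀ : Fin n)
    (ht : ∀ c : Fin n → Fin (k + 1), 1 - eval (gridPoint w c) (sumPowForm n k t) ≠ 0)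
    {x p : MvPolynomial (Fin n) ℂ} (hx : x.IsHomogeneous (n * k)) (hp : eval 0 p = 0) :
    x * p ∈ jacobianIdeal (pencilForm n k t) := by
  rw [← sum_homogeneousComponent p, Finset.mul_sum]
  refine sum_mem fun d _ => ?_
  rcases Nat.eq_zero_or_pos d with rfl | hd
  · have : coeff 0 p = 0 := by rw [← constantCoeff_eq, ← eval_zero, hp]
    rw [homogeneousComponent_zero, this, C_0, mul_zero]
    exact zero_mem _
  · exact mem_jacobianIdeal_of_lt hw i₀ ht
      (hx.mul (homogeneousComponent_isHomogeneous d p)) (by omega)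

/-- This makes `ω` injective on the socle. Nonconstant complementary monomials pair to zero with `q`
because they move it into the ideal; the constant one occurs only in degree `nk`, where `h0`
applies. -/
theorem mem_jacobianIdeal_of_mul_X_mem (hw : IsPrimitiveRoot w (k + 1)) (i₀ : Fin n)
    (ht : ∀ c : Fin n → Fin (k + 1), 1 - eval (gridPoint w c) (sumPowForm n k t) ≠ 0)
    {q : MvPolynomial (Fin n) ℂ} (hq : ∀ i, q * X i ∈ jacobianIdeal (pencilForm n k t))
    (h0 : topResidue k w (sumPowForm n k t) q = 0) : q ∈ jacobianIdeal (pencilForm n k t) := by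
  rw [← sum_homogeneousComponent q]
  refine sum_mem fun d _ => ?_
  have hqd := homogeneousComponent_isHomogeneous d q
  have hX : ∀ i, homogeneousComponent d q * X i ∈ jacobianIdeal (pencilForm n k t) := by
    intro i
    have h1 := homogeneousComponent_mem_jacobianIdeal
      ((mem_homogeneousSubmodule _ _).2 (isHomogeneous_pencilForm n k t)) (hq i) (d + 1)
    have h2 : homogeneousComponent (d + 1) (q * X i) = homogeneousComponent d q * X i := by
      ext b
      rw [coeff_homogeneousComponent, coeff_mul_X', coeff_mul_X', coeff_homogeneousComponent]
      split_ifs with h1 h2 h3 h2 h3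
      · rfl
      · exfalso
        apply h3
        have h4 : b = b - Finsupp.single i 1 + Finsupp.single i 1 := by
          rw [tsub_add_cancel_of_le]
          rw [Finsupp.single_le_iff]
          exact Nat.one_le_iff_ne_zero.2 (Finsupp.mem_support_iff.1 h2)
        rw [h4, map_add, Finsupp.degree_single] at h1
        omega
      · rfl
      · exfalso
        apply h1
        have h4 : b = b - Finsupp.single i 1 + Finsupp.single i 1 := by
          rw [tsub_add_cancel_of_le]
          rw [Finsupp.single_le_iff]
          exact Nat.one_le_iff_ne_zero.2 (Finsupp.mem_support_iff.1 h2)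
        rw [h4, map_add, Finsupp.degree_single, h3]
      · rfl
      · rfl
    rwa [h2] at h1
  refine mem_of_gridResidue_eq_zero hw (isHomogeneous_sumPowForm n k t) i₀ ht
    (X_pow_sub_mem_jacobianIdeal t) hqd fun b hb => ?_
  rw [Nat.add_sub_cancel] at hb
  by_cases hb0 : b = 0
  · subst hb0
    rw [map_zero, add_zero] at hb
    subst hb
    rw [monomial_zero', C_1, mul_one]
    exact h0
  · obtain ⟨i, hi⟩ := Finsupp.ne_iff.1 hb0
    have h4 : Finsupp.single i 1 + (b - Finsupp.single i 1) = b := by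
      rw [add_tsub_cancel_of_le]
      rw [Finsupp.single_le_iff]
      exact Nat.one_le_iff_ne_zero.2 hi
    have h5 : homogeneousComponent d q * monomial b 1 ∈ jacobianIdeal (pencilForm n k t) := by
      rw [← h4, ← one_mul (1 : ℂ), ← monomial_mul, ← mul_assoc]
      exact Ideal.mul_mem_right _ _ (hX i)
    have h6 := topResidue_eq_zero_of_mem hw ht h5
    rwa [topResidue_of_isHomogeneous] at h6
    rw [← hb]
    exact hqd.mul (isHomogeneous_monomial _ rfl)

theorem eq_zero_of_pderiv_pencilForm_eq_zero (hw : IsPrimitiveRoot w (k + 1)) (i₀ : Fin n)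
    (ht : ∀ c : Fin n → Fin (k + 1), 1 - eval (gridPoint w c) (sumPowForm n k t) ≠ 0)
    (z : Fin n → ℂ) (hz : ∀ j, eval z (pderiv j (pencilForm n k t)) = 0) : z = 0 := by
  ext i
  have h := eval_eq_zero_of_mem_jacobianIdeal (mem_jacobianIdeal_of_lt hw i₀ ht
    (isHomogeneous_X_pow i (n * k + 1)) (Nat.lt_succ_self _)) hz
  simpa using h

theorem isHomogeneous_hessian_pencilForm : (hessian (pencilForm n k t)).IsHomogeneous (n * k) := by
  rw [hessian, Matrix.det_apply']
  refine IsHomogeneous.sum _ _ _ fun s _ => ?_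
  have h1 : ∀ i j, (pderiv i (pderiv j (pencilForm n k t))).IsHomogeneous k := fun i j =>
    (isHomogeneous_pencilForm n k t).pderiv.pderiv
  have h2 := IsHomogeneous.prod Finset.univ
    (fun i => Matrix.of (fun i j => pderiv i (pderiv j (pencilForm n k t))) (s i) i) (fun _ => k)
    fun i _ => h1 (s i) i
  have h3 := (isHomogeneous_C (Fin n) ((Equiv.Perm.sign s : ℤ) : ℂ)).mul h2
  simpa using h3

/-- Scaling row `i` of the Hessian matrix by `z i` turns its diagonal part into a scalar matrix, as
`z i ^ (k + 1) = 1`. The rest has rank one, and the matrix determinant lemma applies. -/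
theorem gridPoint_prod_mul_eval_hessian (hw : IsPrimitiveRoot w (k + 1))
    (c : Fin n → Fin (k + 1)) :
    (∏ i, gridPoint w c i) * eval (gridPoint w c) (hessian (pencilForm n k t)) =
      (((k : ℂ) + 2) * (k + 1)) ^ n * (1 - eval (gridPoint w c) (sumPowForm n k t)) := by
  set z := gridPoint w c
  have h1 : Matrix.diagonal z * (eval z).mapMatrix
      (Matrix.of fun i j => pderiv i (pderiv j (pencilForm n k t))) =
      (((k : ℂ) + 2) * (k + 1)) • (1 +
        Matrix.replicateCol Unit (fun i => -(t * (∑ i, z i) ^ k) * z i) *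
          Matrix.replicateRow Unit (fun _ => (1 : ℂ))) := by
    ext i j
    rw [Matrix.diagonal_mul]
    simp only [RingHom.mapMatrix_apply, Matrix.map_apply, Matrix.of_apply,
      pderiv_pderiv_pencilForm, map_mul, map_sub, eval_C, map_pow, map_sum, eval_X,
      Matrix.smul_apply, Matrix.add_apply, Matrix.mul_apply, Matrix.replicateCol_apply,
      Matrix.replicateRow_apply, Matrix.one_apply, smul_eq_mul, Finset.univ_unique,
      Finset.sum_singleton]
    split_ifs with h
    · subst h
      have : z i * z i ^ k = 1 := by rw [← pow_succ', gridPoint_pow hw]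
      simp only [map_pow, eval_X]
      linear_combination (((k : ℂ) + 2) * (k + 1)) * this
    · simp only [map_zero]
      ring
  rw [hessian, RingHom.map_det, ← Matrix.det_diagonal, ← Matrix.det_mul, h1, Matrix.det_smul,
    Matrix.det_one_add_replicateCol_mul_replicateRow, Fintype.card_fin]
  congr 1
  simp only [dotProduct, one_mul, ← Finset.mul_sum, sumPowForm, map_mul, eval_C, map_pow, map_sum,
    eval_X]
  ring

/-- The Hessian cancels the weight at each grid point, so all terms of the residue are the same
nonzero constant. -/
theorem gridResidue_hessian (hw : IsPrimitiveRoot w (k + 1))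
    (ht : ∀ c : Fin n → Fin (k + 1), 1 - eval (gridPoint w c) (sumPowForm n k t) ≠ 0) :
    gridResidue (k + 1) w (sumPowForm n k t) (hessian (pencilForm n k t)) ≠ 0 := by
  have h1 : ∀ c : Fin n → Fin (k + 1), (∏ i, gridPoint w c i) *
      (1 - eval (gridPoint w c) (sumPowForm n k t))⁻¹ *
      eval (gridPoint w c) (hessian (pencilForm n k t)) = (((k : ℂ) + 2) * (k + 1)) ^ n := by
    intro c
    have := gridPoint_prod_mul_eval_hessian (t := t) hw c
    have h0 := ht c
    rw [mul_right_comm, this]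
    field_simp
  rw [gridResidue_apply]
  simp only [h1]
  have hk : ((k : ℂ) + 2) * (k + 1) ≠ 0 := by exact_mod_cast (by positivity : (k + 2) * (k + 1) ≠ 0)
  have hk' : (k : ℂ) + 1 ≠ 0 := by exact_mod_cast (by omega : k + 1 ≠ 0)
  simp [hk]
  exact fun h => absurd h hk'

end Milnor

/-! ### Sums of powers of linear forms -/

section PowerSum

variable {n : ℕ}

/-- The sum `∑ a_ι (p_ι · z) ^ d` of powers of linear forms. -/
def powerSum {ι : Type*} [Fintype ι] (d : ℕ) (p : ι → Fin n → ℂ) (a : ι → ℂ) :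
    MvPolynomial (Fin n) ℂ :=
  ∑ c, C (a c) * (∑ i, C (p c i) * X i) ^ d

theorem isHomogeneous_sum_C_mul_X_pow (z : Fin n → ℂ) (d : ℕ) :
    ((∑ i, C (z i) * X i : MvPolynomial (Fin n) ℂ) ^ d).IsHomogeneous d := by
  have h : (∑ i, C (z i) * X i : MvPolynomial (Fin n) ℂ).IsHomogeneous 1 :=
    IsHomogeneous.sum _ _ _ fun i _ => by
      simpa using (isHomogeneous_C (Fin n) (z i)).mul (isHomogeneous_X ℂ i)
  simpa using h.pow d

theorem isHomogeneous_powerSum {ι : Type*} [Fintype ι] (d : ℕ) (p : ι → Fin n → ℂ) (a : ι → ℂ) :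
    (powerSum d p a).IsHomogeneous d :=
  IsHomogeneous.sum _ _ _ fun c _ => by
    simpa using (isHomogeneous_C (Fin n) (a c)).mul (isHomogeneous_sum_C_mul_X_pow (p c) d)

theorem eval_powerSum {ι : Type*} [Fintype ι] (d : ℕ) (p : ι → Fin n → ℂ) (a : ι → ℂ)
    (z : Fin n → ℂ) : eval z (powerSum d p a) = ∑ c, a c * (∑ i, p c i * z i) ^ d := by
  simp [powerSum]

theorem eval_pderiv_powerSum {ι : Type*} [Fintype ι] (d : ℕ) (p : ι → Fin n → ℂ) (a : ι → ℂ)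
    (z : Fin n → ℂ) (j : Fin n) :
    eval z (pderiv j (powerSum d p a)) = d * ∑ c, a c * p c j * (∑ i, p c i * z i) ^ (d - 1) := by
  have h : ∀ c, pderiv j (∑ i, C (p c i) * X i : MvPolynomial (Fin n) ℂ) = C (p c j) := by
    intro c
    rw [map_sum, Finset.sum_eq_single j]
    · simp
    · intro i _ hi
      simp [pderiv_X_of_ne hi]
    · simp
  simp only [powerSum, map_sum, pderiv_C_mul, pderiv_pow, h, map_mul, eval_C, map_natCast, map_pow,
    eval_X, Finset.mul_sum]
  exact Finset.sum_congr rfl fun c _ => by ring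

end PowerSum

/-! ### The associated form of the pencil -/

section Associated

variable {n k : ℕ} {w t : ℂ}

/-- The associated form of `pencilForm n k t`, up to the factor `ω(Hess)`. -/
def pencilDual (n k : ℕ) (w t : ℂ) : MvPolynomial (Fin n) ℂ :=
  powerSum (n * k) (fun c : Fin n → Fin (k + 1) => gridPoint w c) fun c =>
    (∏ i, gridPoint w c i) * (1 - eval (gridPoint w c) (sumPowForm n k t))⁻¹

theorem exists_milnor_functional (Q : MvPolynomial (Fin n) ℂ) (φ : MvPolynomial (Fin n) ℂ →ₗ[ℂ] ℂ)
    (hφ : ∀ p ∈ jacobianIdeal Q, φ p = 0) :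
    ∃ ψ : MilnorAlgebra Q →ₗ[ℂ] ℂ, ∀ q, ψ (milnorMk Q q) = φ q := by
  obtain ⟨g, hg⟩ := (milnorMk Q).toLinearMap.exists_rightInverse_of_surjective
    (LinearMap.range_eq_top.2 (Ideal.Quotient.mkₐ_surjective ℂ _))
  refine ⟨φ ∘ₗ g, fun q => ?_⟩
  have h1 : milnorMk Q (g (milnorMk Q q)) = milnorMk Q q := LinearMap.congr_fun hg (milnorMk Q q)
  have h2 : g (milnorMk Q q) - q ∈ jacobianIdeal Q := Ideal.Quotient.eq.1 h1
  have h3 := hφ _ h2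
  rw [map_sub] at h3
  exact sub_eq_zero.1 h3

theorem exists_eq_of_mem_milnorMaximalIdeal {Q : MvPolynomial (Fin n) ℂ} {y : MilnorAlgebra Q}
    (hy : y ∈ milnorMaximalIdeal Q) : ∃ p, eval 0 p = 0 ∧ milnorMk Q p = y :=
  (Ideal.mem_map_iff_of_surjective _ (Ideal.Quotient.mkₐ_surjective ℂ _)).1 hy

theorem milnorMk_mem_socle (hw : IsPrimitiveRoot w (k + 1)) (hn : 0 < n) (hk : 0 < k)
    (ht : ∀ c : Fin n → Fin (k + 1), 1 - eval (gridPoint w c) (sumPowForm n k t) ≠ 0)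
    {x : MvPolynomial (Fin n) ℂ} (hx : x.IsHomogeneous (n * k)) :
    milnorMk (pencilForm n k t) x ∈ socle (pencilForm n k t) := by
  refine ⟨Ideal.mem_map_of_mem _ ?_, fun y hy => ?_⟩
  · rw [RingHom.mem_ker, eval_zero, constantCoeff_eq]
    refine hx.coeff_eq_zero ?_
    rw [map_zero]
    exact (Nat.mul_pos hn hk).ne
  · obtain ⟨p, hp, rfl⟩ := exists_eq_of_mem_milnorMaximalIdeal hy
    rw [← map_mul]
    exact Ideal.Quotient.eq_zero_iff_mem.2 (mul_mem_jacobianIdeal hw ⟨0, hn⟩ ht hx hp)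

theorem isAssociatedForm_pencilForm (hw : IsPrimitiveRoot w (k + 1)) (hn : 0 < n) (hk : 0 < k)
    (ht : ∀ c : Fin n → Fin (k + 1), 1 - eval (gridPoint w c) (sumPowForm n k t) ≠ 0) :
    ∃ a : ℂ, a ≠ 0 ∧ IsAssociatedForm (k + 2) (pencilForm n k t) (C a * pencilDual n k w t) := by
  set Q := pencilForm n k t
  set e₀ := gridResidue (k + 1) w (sumPowForm n k t) (hessian Q) with he₀
  have hne : e₀ ≠ 0 := gridResidue_hessian hw ht
  obtain ⟨ψ, hψ⟩ := exists_milnor_functional Q (topResidue k w (sumPowForm n k t))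
    fun p hp => topResidue_eq_zero_of_mem hw ht hp
  have hψ' : ∀ q : MvPolynomial (Fin n) ℂ, q.IsHomogeneous (n * k) →
      ψ (milnorMk Q q) = gridResidue (k + 1) w (sumPowForm n k t) q := fun q hq => by
    rw [hψ, topResidue_of_isHomogeneous hq]
  have hH : milnorMk Q (hessian Q) ∈ socle Q :=
    milnorMk_mem_socle hw hn hk ht isHomogeneous_hessian_pencilForm
  -- The residue rescaled to be `1` on the Hessian. Its bijectivity shows at the same time that the
  -- socle is one-dimensional.
  let ω₀ : socle Q →ₗ[ℂ] ℂ := e₀⁻¹ • ψ ∘ₗ (socle Q).subtype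
  have hω₀ : ∀ x : socle Q, ω₀ x = e₀⁻¹ * ψ x := fun x => rfl
  have hω₁ : ω₀ ⟨milnorMk Q (hessian Q), hH⟩ = 1 := by
    rw [hω₀, hψ' _ isHomogeneous_hessian_pencilForm, ← he₀, inv_mul_cancel₀ hne]
  have hinj : Function.Injective ω₀ := by
    rw [← LinearMap.ker_eq_bot, LinearMap.ker_eq_bot']
    rintro ⟨x, hx⟩ h0
    obtain ⟨q, rfl⟩ := Ideal.Quotient.mkₐ_surjective ℂ (jacobianIdeal Q) x
    have h1 : topResidue k w (sumPowForm n k t) q = 0 := by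
      rw [hω₀] at h0
      rw [← hψ]
      exact (mul_eq_zero.1 h0).resolve_left (inv_ne_zero hne)
    refine Subtype.ext (Ideal.Quotient.eq_zero_iff_mem.2
      (mem_jacobianIdeal_of_mul_X_mem hw ⟨0, hn⟩ ht (fun i => ?_) h1))
    have h2 := hx.2 (milnorMk Q (X i)) (Ideal.mem_map_of_mem _ (by simp))
    rw [← map_mul] at h2
    exact Ideal.Quotient.eq_zero_iff_mem.1 h2
  have hsurj : Function.Surjective ω₀ := fun a => ⟨a • ⟨milnorMk Q (hessian Q), hH⟩, by
    rw [map_smul, hω₁, smul_eq_mul, mul_one]⟩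
  have hbij : Function.Bijective ω₀ := ⟨hinj, hsurj⟩
  refine ⟨e₀⁻¹, inv_ne_zero hne, ?_, LinearEquiv.ofBijective ω₀ hbij, hH, hω₁, fun z => ?_⟩
  · rw [Nat.add_sub_cancel, mem_homogeneousSubmodule]
    rw [← zero_add (n * k)]
    exact (isHomogeneous_C (Fin n) e₀⁻¹).mul (isHomogeneous_powerSum (n * k) _ _)
  · rw [Nat.add_sub_cancel]
    have hL : (∑ j, z j • milnorMk Q (X j)) ^ (n * k) =
        milnorMk Q ((∑ i, C (z i) * X i) ^ (n * k)) := by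
      rw [map_pow, map_sum]
      congr 1
      exact Finset.sum_congr rfl fun i _ => by rw [← smul_eq_C_mul, map_smul]
    refine ⟨hL ▸ milnorMk_mem_socle hw hn hk ht (isHomogeneous_sum_C_mul_X_pow z _), ?_⟩
    change _ = e₀⁻¹ * ψ ((∑ j, z j • milnorMk Q (X j)) ^ (n * k))
    rw [hL, map_mul, eval_C, pencilDual, eval_powerSum, hψ' _ (isHomogeneous_sum_C_mul_X_pow z _), gridResidue_apply]
    simp only [map_pow, map_sum, map_mul, eval_C, eval_X, mul_comm (z _)]

theorem exists_pencilForm_of_nonsingular (hw : IsPrimitiveRoot w (k + 1)) (hn : 0 < n) (hk : 0 < k)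
    (ht : ∀ c : Fin n → Fin (k + 1), 1 - eval (gridPoint w c) (sumPowForm n k t) ≠ 0)
    (hR : ∀ z : Fin n → ℂ, (∀ j, eval z (pderiv j (pencilDual n k w t)) = 0) → z = 0) :
    ∃ Q ∈ nondegenerateForms n (k + 2), ∃ R : MvPolynomial (Fin n) ℂ,
      IsAssociatedForm (k + 2) Q R ∧ discriminant n (n * (k + 2 - 2)) R ≠ 0 := by
  obtain ⟨a, ha, hR'⟩ := isAssociatedForm_pencilForm hw hn hk ht
  refine ⟨pencilForm n k t, ⟨(isHomogeneous_pencilForm n k t), discriminant_ne_zero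
    (isHomogeneous_pencilForm n k t) (eq_zero_of_pderiv_pencilForm_eq_zero hw ⟨0, hn⟩ ht)⟩, _, hR',
    discriminant_ne_zero hR'.1 fun z hz => hR z fun j => ?_⟩
  have := hz j
  rw [pderiv_C_mul, map_mul, eval_C] at this
  exact (mul_eq_zero.1 this).resolve_left ha

end Associated

/-! ### Grid points whose coordinate sum has prescribed `e`-th power -/

section RootsOfUnity

variable {e : ℕ}

/-- `ρ` is a root of unity of order dividing `e` that is closest to `1` among those other than `1`. -/
structure IsNearestRoot (ρ : ℂ) (e : ℕ) : Prop where
  pow_eq_one : ρ ^ e = 1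
  ne_one : ρ ≠ 1
  re_le : ∀ v : ℂ, v ^ e = 1 → v ≠ 1 → v.re ≤ ρ.re

theorem exists_isNearestRoot (he : 2 ≤ e) : ∃ ρ, IsNearestRoot ρ e := by
  have hw := Complex.isPrimitiveRoot_exp e (by omega)
  set w := Complex.exp (2 * Real.pi * Complex.I / e)
  obtain ⟨j, hj, hmax⟩ := Finset.exists_max_image (Finset.Ico 1 e) (fun j => (w ^ j).re)
    ⟨1, Finset.mem_Ico.2 ⟨le_rfl, he⟩⟩
  rw [Finset.mem_Ico] at hj
  have : NeZero e := ⟨by omega⟩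
  refine ⟨w ^ j, by rw [← pow_mul, mul_comm, pow_mul, hw.pow_eq_one, one_pow],
    hw.pow_ne_one_of_pos_of_lt (by omega) hj.2, fun v hv hv1 => ?_⟩
  obtain ⟨i, hi, rfl⟩ := hw.eq_pow_of_pow_eq_one hv
  refine hmax i (Finset.mem_Ico.2 ⟨?_, hi⟩)
  rcases Nat.eq_zero_or_pos i with rfl | h
  · simp at hv1
  · exact h

theorem normSq_eq_one_of_pow_eq_one (he : e ≠ 0) {v : ℂ} (hv : v ^ e = 1) :
    v.re ^ 2 + v.im ^ 2 = 1 := by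
  have h1 := Complex.norm_eq_one_of_pow_eq_one hv he
  have h2 := Complex.normSq_eq_norm_sq v
  rw [h1, Complex.normSq_apply] at h2
  nlinarith

theorem normSq_natCast_sub_one_add (he : e ≠ 0) (n : ℕ) {v : ℂ} (hv : v ^ e = 1) :
    Complex.normSq ((n : ℂ) - 1 + v) = (n : ℝ) ^ 2 - 2 * (n - 1) * (1 - v.re) := by
  have h := normSq_eq_one_of_pow_eq_one he hv
  rw [Complex.normSq_apply]
  simp
  nlinarith

/-- On the unit circle `u * conj v = u / v`, again an `e`-th root of unity, equal to `1` only when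
`u = v`. -/
theorem re_mul_conj_le (he : e ≠ 0) {ρ : ℂ} (hρ : IsNearestRoot ρ e) {u v : ℂ} (hu : u ^ e = 1)
    (hv : v ^ e = 1) :
    (u * (starRingEnd ℂ) v).re ≤ 1 - (if v = u then 0 else 1) * (1 - ρ.re) := by
  have hvv : v * (starRingEnd ℂ) v = 1 := by
    rw [Complex.mul_conj, Complex.normSq_eq_norm_sq, Complex.norm_eq_one_of_pow_eq_one hv he]
    simp
  split_ifs with h
  · subst h
    rw [hvv]
    simp
  · have h1 : (u * (starRingEnd ℂ) v) ^ e = 1 := by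
      rw [mul_pow, ← map_pow, hu, hv]
      simp
    have h2 : u * (starRingEnd ℂ) v ≠ 1 := by
      intro h3
      apply h
      have : u * ((starRingEnd ℂ) v * v) = v := by rw [← mul_assoc, h3, one_mul]
      rw [mul_comm _ v, hvv, mul_one] at this
      exact this.symm
    have := hρ.re_le _ h1 h2
    linarith

theorem IsNearestRoot.re_lt_one (he : e ≠ 0) {ρ : ℂ} (hρ : IsNearestRoot ρ e) : ρ.re < 1 := by
  have h := normSq_eq_one_of_pow_eq_one he hρ.pow_eq_one
  by_contra! h1
  have h2 : ρ.re = 1 := by nlinarith [sq_nonneg ρ.im]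
  have h3 : ρ.im = 0 := by
    rw [h2] at h
    nlinarith [sq_nonneg ρ.im]
  exact hρ.ne_one (Complex.ext h2 h3)

/-- The point with coordinate `ρ` at `i` and all other coordinates `1`. -/
def nodePoint {n : ℕ} (ρ : ℂ) (i : Fin n) : Fin n → ℂ := fun j => if j = i then ρ else 1

theorem sum_nodePoint_mul {n : ℕ} (ρ : ℂ) (i : Fin n) (y : Fin n → ℂ) :
    ∑ j, nodePoint ρ i j * y j = ∑ j, y j + (ρ - 1) * y i := by
  have : ∀ j, nodePoint ρ i j * y j = y j + if j = i then (ρ - 1) * y j else 0 := fun j => by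
    rw [nodePoint]
    split_ifs <;> ring
  simp [this, Finset.sum_add_distrib]

theorem nodePoint_comm {n : ℕ} (ρ : ℂ) (i j : Fin n) : nodePoint ρ i j = nodePoint ρ j i := by
  simp [nodePoint, eq_comm]

/-- The matrix is the all-ones matrix plus `(ρ - 1)` times the identity; its eigenvalues are among
`ρ - 1` and `n - 1 + ρ`. -/
theorem eq_zero_of_sum_nodePoint_mul {n : ℕ} {ρ : ℂ} (h1 : ρ ≠ 1) (hX : (n : ℂ) - 1 + ρ ≠ 0)
    {y : Fin n → ℂ} (hy : ∀ i, ∑ j, nodePoint ρ i j * y j = 0) : y = 0 := by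
  simp only [sum_nodePoint_mul] at hy
  have h2 : ((n : ℂ) - 1 + ρ) * ∑ j, y j = 0 := by
    have := Finset.sum_congr rfl fun i (_ : i ∈ Finset.univ) => hy i
    rw [Finset.sum_add_distrib, ← Finset.mul_sum] at this
    simp at this
    linear_combination this
  have h3 := (mul_eq_zero.1 h2).resolve_left hX
  ext i
  have h4 := hy i
  rw [h3, zero_add] at h4
  exact (mul_eq_zero.1 h4).resolve_left (sub_ne_zero.2 h1)

/-- If the coordinate sum of a point of `μ_e ^ n` has the modulus of that of `nodePoint ρ i`, then all
coordinates of the point but one are equal. -/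
theorem exists_eq_smul_nodePoint_of_normSq {n : ℕ} (he : e ≠ 0) (hn : 2 ≤ n) {ρ : ℂ}
    (hρ : IsNearestRoot ρ e) {v : Fin n → ℂ} (hv : ∀ i, v i ^ e = 1)
    (hnorm : Complex.normSq (∑ i, v i) = Complex.normSq ((n : ℂ) - 1 + ρ)) :
    ∃ (i j : Fin n) (u η : ℂ), i ≠ j ∧ u ^ e = 1 ∧ η ^ e = 1 ∧ η.re = ρ.re ∧ v = u • nodePoint η i := by
  classical
  have hc := hρ.re_lt_one he
  have hn' : (2 : ℝ) ≤ n := by exact_mod_cast hn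
  rw [normSq_natCast_sub_one_add he n hρ.pow_eq_one] at hnorm
  have hv0 : ∀ i, v i ≠ 0 := fun i h => by
    have := hv i
    rw [h, zero_pow he] at this
    exact zero_ne_one this
  have hexp : Complex.normSq (∑ i, v i) = ∑ i, ∑ j, (v i * (starRingEnd ℂ) (v j)).re := by
    have h1 : ((Complex.normSq (∑ i, v i) : ℝ) : ℂ) = ∑ i, ∑ j, v i * (starRingEnd ℂ) (v j) := by
      rw [← Complex.mul_conj, map_sum, Finset.sum_mul_sum]
    have h2 := congrArg Complex.re h1
    simpa only [Complex.ofReal_re, Complex.re_sum] using h2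
  -- In the expansion of `|∑ v i|²` each ordered pair of unequal coordinates costs at least `1 -
  -- ρ.re`. The prescribed modulus allows at most `2(n - 1)` such pairs, so some coordinate differs
  -- from at most one other.
  let d : Fin n → ℕ := fun i => (Finset.univ.filter fun j => v j ≠ v i).card
  have hrow : ∀ i, ∑ j, (v i * (starRingEnd ℂ) (v j)).re ≤ n - d i * (1 - ρ.re) := by
    intro i
    calc ∑ j, (v i * (starRingEnd ℂ) (v j)).re
        ≤ ∑ j, (1 - (if v j = v i then 0 else 1) * (1 - ρ.re)) :=
          Finset.sum_le_sum fun j _ => re_mul_conj_le he hρ (hv i) (hv j)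
      _ = n - d i * (1 - ρ.re) := by
          rw [Finset.sum_sub_distrib, ← Finset.sum_mul]
          simp [d, Finset.card_filter, ite_not]
  have htot : (n : ℝ) ^ 2 - 2 * (n - 1) * (1 - ρ.re) ≤ n ^ 2 - (∑ i, d i : ℕ) * (1 - ρ.re) := by
    rw [← hnorm, hexp]
    refine (Finset.sum_le_sum fun i _ => hrow i).trans (le_of_eq ?_)
    rw [Finset.sum_sub_distrib, ← Finset.sum_mul]
    simp [sq]
  have hsum : ∑ i, d i < 2 * n := by
    have h1 : ((∑ i, d i : ℕ) : ℝ) ≤ 2 * (n - 1) := by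
      by_contra! h
      nlinarith
    have h2 : ((∑ i, d i : ℕ) : ℝ) < (2 * n : ℕ) := by
      push_cast at h1 ⊢
      linarith
    exact_mod_cast h2
  obtain ⟨j, hj⟩ : ∃ j, d j ≤ 1 := by
    by_contra! h
    have : ∑ _i : Fin n, 2 ≤ ∑ i, d i := Finset.sum_le_sum fun i _ => h i
    simp at this
    omega
  have hne : d j ≠ 0 := by
    intro h0
    have hall : ∀ i, v i = v j := fun i => by
      by_contra hi
      have : i ∈ Finset.univ.filter fun l => v l ≠ v j := by simp [hi]
      rw [Finset.card_eq_zero.1 h0] at this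
      simp at this
    have h1 : Complex.normSq (∑ i, v i) = (n : ℝ) ^ 2 := by
      simp only [hall, Finset.sum_const, Finset.card_univ, Fintype.card_fin, nsmul_eq_mul, map_mul,
        Complex.normSq_natCast]
      rw [Complex.normSq_eq_norm_sq, Complex.norm_eq_one_of_pow_eq_one (hv j) he]
      ring
    rw [h1] at hnorm
    nlinarith
  obtain ⟨i, hi⟩ := Finset.card_eq_one.1 (by omega : d j = 1)
  have hiff : ∀ l, v l ≠ v j ↔ l = i := fun l => by
    have := Finset.ext_iff.1 hi l
    simpa using this
  have hvη : v = v j • nodePoint (v i / v j) i := by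
    ext l
    rw [Pi.smul_apply, smul_eq_mul, nodePoint]
    split_ifs with h
    · rw [h, mul_div_cancel₀ _ (hv0 j)]
    · rw [mul_one]
      by_contra h2
      exact h ((hiff l).1 h2)
  have hη : (v i / v j) ^ e = 1 := by rw [div_pow, hv, hv, div_one]
  refine ⟨i, j, v j, v i / v j, ?_, hv j, hη, ?_, hvη⟩
  · rintro rfl
    exact (hiff i).2 rfl rfl
  · have h1 : ∑ l, v l = v j * ((n : ℂ) - 1 + v i / v j) := by
      have h2 := sum_nodePoint_mul (v i / v j) i fun _ => 1
      simp only [mul_one, Finset.sum_const, Finset.card_univ, Fintype.card_fin, nsmul_eq_mul] at h2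
      conv_lhs => rw [hvη]
      simp only [Pi.smul_apply, smul_eq_mul]
      rw [← Finset.mul_sum, h2]
      ring
    rw [h1, map_mul, normSq_natCast_sub_one_add he n hη, Complex.normSq_eq_norm_sq (v j),
      Complex.norm_eq_one_of_pow_eq_one (hv j) he] at hnorm
    nlinarith

theorem exists_eq_smul_nodePoint {n : ℕ} (he : e ≠ 0) (hn : 2 ≤ n) {ρ : ℂ}
    (hρ : IsNearestRoot ρ e) (hX : (n : ℂ) - 1 + ρ ≠ 0) {v : Fin n → ℂ} (hv : ∀ i, v i ^ e = 1)
    (hpow : (∑ i, v i) ^ e = ((n : ℂ) - 1 + ρ) ^ e) :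
    ∃ (i : Fin n) (u : ℂ), u ^ e = 1 ∧ v = u • nodePoint ρ i := by
  have hnorm : Complex.normSq (∑ i, v i) = Complex.normSq ((n : ℂ) - 1 + ρ) := by
    rw [Complex.normSq_eq_norm_sq, Complex.normSq_eq_norm_sq]
    congr 1
    refine (pow_left_inj₀ (norm_nonneg _) (norm_nonneg _) he).1 ?_
    rw [← norm_pow, hpow, norm_pow]
  obtain ⟨i, j, u, η, hij, hu, hη, hre, rfl⟩ :=
    exists_eq_smul_nodePoint_of_normSq he hn hρ hv hnorm
  have hη1 := normSq_eq_one_of_pow_eq_one he hη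
  have hρ1 := normSq_eq_one_of_pow_eq_one he hρ.pow_eq_one
  by_cases hηρ : η = ρ
  · exact ⟨i, u, hu, by rw [hηρ]⟩
  have him : η.im = -ρ.im := by
    have : (η.im - ρ.im) * (η.im + ρ.im) = 0 := by
      rw [hre] at hη1
      linear_combination hη1 - hρ1
    rcases mul_eq_zero.1 this with h | h
    · exact absurd (Complex.ext hre (by linarith)) hηρ
    · linarith
  have hηρ1 : η * ρ = 1 := by
    apply Complex.ext
    · simp [hre, him]
      nlinarith
    · simp [hre, him]
      ring
  rcases Nat.lt_or_ge 2 n with hn3 | hn2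
  -- The modulus cannot tell `ρ` from its conjugate `η`. If `η ≠ ρ`, then `V` is an `e`-th root of
  -- unity other than `1`, and for `n ≥ 3` it is nearer to `1` than `ρ`: the comparison reduces to
  -- the sign of `(1 - ρ.re)(n - 2)(n + 2 ρ.re)`.
  · exfalso
    have hc := hρ.re_lt_one he
    have hn3' : (3 : ℝ) ≤ n := by exact_mod_cast hn3
    set V := ((n : ℂ) - 1 + η) / ((n : ℂ) - 1 + ρ) with hV
    have hsum : ∑ l, (u • nodePoint η i) l = u * ((n : ℂ) - 1 + η) := by
      have h2 := sum_nodePoint_mul η i fun _ => 1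
      simp only [mul_one, Finset.sum_const, Finset.card_univ, Fintype.card_fin, nsmul_eq_mul] at h2
      simp only [Pi.smul_apply, smul_eq_mul]
      rw [← Finset.mul_sum, h2]
      ring
    have hVe : V ^ e = 1 := by
      rw [hsum, mul_pow, hu, one_mul] at hpow
      rw [hV, div_pow, hpow, div_self (pow_ne_zero _ hX)]
    have hVX : V * ((n : ℂ) - 1 + ρ) = (n : ℂ) - 1 + η := div_mul_cancel₀ _ hX
    have hV1 : V ≠ 1 := by
      intro h
      rw [h, one_mul] at hVX
      exact hηρ (by linear_combination -hVX)
    have hVre := hρ.re_le V hVe hV1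
    have h1 := congrArg Complex.re hVX
    have h2 := congrArg Complex.im hVX
    simp [hre, him] at h1 h2
    have h3 : V.re * ((n - 1 + ρ.re) ^ 2 + ρ.im ^ 2) = (n - 1 + ρ.re) ^ 2 - ρ.im ^ 2 := by
      linear_combination (n - 1 + ρ.re) * h1 + ρ.im * h2
    have him0 : ρ.im ≠ 0 := fun h => hηρ (Complex.ext hre (by rw [him, h, neg_zero]))
    have hS : 0 < (n - 1 + ρ.re) ^ 2 + ρ.im ^ 2 := by positivity
    have h4 : (n - 1 + ρ.re) ^ 2 - ρ.im ^ 2 ≤ ρ.re * ((n - 1 + ρ.re) ^ 2 + ρ.im ^ 2) := by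
      rw [← h3]
      exact mul_le_mul_of_nonneg_right hVre hS.le
    have h5 : ρ.im ^ 2 = 1 - ρ.re ^ 2 := by linarith
    rw [h5] at h4
    have h6 : (1 - ρ.re) * (((n : ℝ) - 2) * (n + 2 * ρ.re)) ≤ 0 := by nlinarith
    have hc' : -1 ≤ ρ.re := by nlinarith [sq_nonneg ρ.im]
    have h7 : 0 < (1 - ρ.re) * (((n : ℝ) - 2) * (n + 2 * ρ.re)) :=
      mul_pos (by linarith) (mul_pos (by linarith) (by linarith))
    linarith
  -- For `n = 2` the conjugate gives nothing new: `(η, 1) = η • (1, ρ)`, the other node.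
  · refine ⟨j, u * η, by rw [mul_pow, hu, hη, one_mul], ?_⟩
    ext l
    simp only [Pi.smul_apply, smul_eq_mul, nodePoint]
    have hl : l = i ∨ l = j := by
      have := l.2
      have := i.2
      have := j.2
      simp only [Fin.ext_iff] at hij ⊢
      omega
    rcases hl with rfl | rfl
    · rw [if_pos rfl, if_neg hij, mul_one]
    · rw [if_neg hij.symm, if_pos rfl, mul_assoc, hηρ1]

end RootsOfUnity

/-! ### Degeneration to a Fermat form -/

section Degeneration

variable {n k : ℕ} {w : ℂ}

theorem eval_sumPowForm (t : ℂ) (z : Fin n → ℂ) :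
    eval z (sumPowForm n k t) = t * (∑ i, z i) ^ (k + 1) := by
  simp [sumPowForm]

theorem continuous_formCoeffs_powerSum {ι : Type*} [Fintype ι] (d : ℕ) (p : ι → Fin n → ℂ) :
    Continuous fun a : ι → ℂ => formCoeffs n d (powerSum d p a) := by
  refine continuous_pi fun b => ?_
  simp only [formCoeffs, powerSum, coeff_sum, coeff_C_mul]
  fun_prop

/-- Nonsingularity is an open condition on sums of powers of fixed linear forms. -/
theorem eventually_powerSum_nonsingular {ι : Type*} [Fintype ι] {d : ℕ} {p : ι → Fin n → ℂ}
    {a : ι → ℂ}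
    (ha : ∀ z : Fin n → ℂ, (∀ j, eval z (pderiv j (powerSum d p a)) = 0) → z = 0) :
    ∀ᶠ b in 𝓝 a, ∀ z : Fin n → ℂ, (∀ j, eval z (pderiv j (powerSum d p b)) = 0) → z = 0 := by
  obtain ⟨f, hf, hne⟩ := exists_mem_vanishingIdeal_eval_ne_zero
    ((mem_homogeneousSubmodule _ _).2 (isHomogeneous_powerSum d p a)) ha
  have hcont : Continuous fun b => eval (formCoeffs n d (powerSum d p b)) f :=
    (MvPolynomial.continuous_eval f).comp (continuous_formCoeffs_powerSum d p)
  filter_upwards [hcont.continuousAt.eventually_ne hne] with b hb z hz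
  by_contra h0
  exact hb (mem_vanishingIdeal_iff.1 hf _
    ⟨_, ⟨isHomogeneous_powerSum d p b, z, h0, hz⟩, rfl⟩)

/-- The leading term of `pencilDual` at the value of `t` at which the points of `μ_e ^ n`
proportional to some `nodePoint ρ i` become singular on the pencil. -/
theorem nonsingular_powerSum_node (hw : IsPrimitiveRoot w (k + 1)) (hn : 2 ≤ n) (hk : 0 < k) {ρ : ℂ}
    (hρ : IsNearestRoot ρ (k + 1)) (hX : (n : ℂ) - 1 + ρ ≠ 0) (z : Fin n → ℂ)
    (hz : ∀ j, eval z (pderiv j (powerSum (n * k) (fun c : Fin n → Fin (k + 1) => gridPoint w c)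
      fun c => (∏ i, gridPoint w c i) *
        if (∑ i, gridPoint w c i) ^ (k + 1) = ((n : ℂ) - 1 + ρ) ^ (k + 1) then 1 else 0)) = 0) :
    z = 0 := by
  classical
  have hT : 0 < n * k := Nat.mul_pos (by omega) hk
  set nodes : Finset (Fin n → Fin (k + 1)) := Finset.univ.filter fun c =>
    (∑ i, gridPoint w c i) ^ (k + 1) = ((n : ℂ) - 1 + ρ) ^ (k + 1) with hnodes
  have hcl : ∀ c : Fin n → Fin (k + 1), ∃ (i : Fin n) (u : ℂ), c ∈ nodes →
      u ^ (k + 1) = 1 ∧ gridPoint w c = u • nodePoint ρ i := by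
    intro c
    by_cases hc : c ∈ nodes
    · obtain ⟨i, u, h⟩ := exists_eq_smul_nodePoint k.succ_ne_zero hn hρ hX (gridPoint_pow hw c)
        (Finset.mem_filter.1 hc).2
      exact ⟨i, u, fun _ => h⟩
    · exact ⟨⟨0, by omega⟩, 0, fun h => absurd h hc⟩
  choose ι u hιu using hcl
  have hρ0 : ρ ≠ 0 := fun h => by
    have := hρ.pow_eq_one
    rw [h, zero_pow k.succ_ne_zero] at this
    exact zero_ne_one this
  have hterm : ∀ c ∈ nodes, ∀ j, (∏ i, gridPoint w c i) * gridPoint w c j *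
      (∑ i, gridPoint w c i * z i) ^ (n * k - 1) =
      ρ * nodePoint ρ (ι c) j * (∑ i, nodePoint ρ (ι c) i * z i) ^ (n * k - 1) := by
    intro c hc j
    obtain ⟨h1, h2⟩ := hιu c hc
    have hprod : ∏ i, nodePoint ρ (ι c) i = ρ := by simp [nodePoint]
    -- The total exponent is `n (k + 1)`, so the terms of proportional grid points are equal and add
    -- up without cancellation.
    have hupow : u c ^ n * u c * u c ^ (n * k - 1) = 1 := by
      rw [← pow_succ, ← pow_add, show n + 1 + (n * k - 1) = (k + 1) * n by
        rw [add_mul, mul_comm k n]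
        omega, pow_mul, h1, one_pow]
    simp only [h2, Pi.smul_apply, smul_eq_mul, Finset.prod_mul_distrib, hprod, Finset.prod_const,
      Finset.card_univ, Fintype.card_fin, mul_assoc, ← Finset.mul_sum, mul_pow]
    linear_combination (ρ * nodePoint ρ (ι c) j *
      (∑ i, nodePoint ρ (ι c) i * z i) ^ (n * k - 1)) * hupow
  have hgrad : ∀ j, ∑ i, nodePoint ρ j i * ((nodes.filter fun c => ι c = i).card *
      (ρ * (∑ l, nodePoint ρ i l * z l) ^ (n * k - 1))) = 0 := by
    intro j
    have h1 := hz j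
    rw [eval_pderiv_powerSum] at h1
    have h2 := (mul_eq_zero.1 h1).resolve_left (Nat.cast_ne_zero.2 hT.ne')
    have h3 : ∑ c ∈ nodes, (∏ i, gridPoint w c i) * gridPoint w c j *
        (∑ i, gridPoint w c i * z i) ^ (n * k - 1) = 0 := by
      rw [← h2, hnodes, Finset.sum_filter]
      refine Finset.sum_congr rfl fun c _ => ?_
      split_ifs <;> ring
    rw [Finset.sum_congr rfl fun c hc => hterm c hc j,
      ← Finset.sum_fiberwise_of_maps_to (fun c _ => Finset.mem_univ (ι c))] at h3
    rw [← h3]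
    refine Finset.sum_congr rfl fun i _ => ?_
    have h4 : ∀ c ∈ nodes.filter fun c => ι c = i, ρ * nodePoint ρ (ι c) j *
        (∑ l, nodePoint ρ (ι c) l * z l) ^ (n * k - 1) =
        ρ * nodePoint ρ i j * (∑ l, nodePoint ρ i l * z l) ^ (n * k - 1) := fun c hc => by
      rw [(Finset.mem_filter.1 hc).2]
    rw [Finset.sum_congr rfl h4, Finset.sum_const, nsmul_eq_mul, nodePoint_comm]
    ring
  have hfiber : ∀ i, (nodes.filter fun c => ι c = i).card ≠ 0 := by
    intro i
    obtain ⟨c, hc⟩ := exists_gridPoint_eq hw (v := nodePoint ρ i) fun j => by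
      rw [nodePoint]
      split_ifs
      · exact hρ.pow_eq_one
      · exact one_pow _
    have hcn : c ∈ nodes := by
      refine Finset.mem_filter.2 ⟨Finset.mem_univ _, ?_⟩
      have h2 := sum_nodePoint_mul ρ i fun _ => 1
      simp only [mul_one, Finset.sum_const, Finset.card_univ, Fintype.card_fin, nsmul_eq_mul] at h2
      rw [hc, h2]
      ring
    refine Finset.card_ne_zero_of_mem (a := c) (Finset.mem_filter.2 ⟨hcn, ?_⟩)
    -- The index `ι c` was chosen arbitrarily, but it must be `i`, since distinct nodes are linearly
    -- independent.
    by_contra hne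
    obtain ⟨-, h2⟩ := hιu c hcn
    rw [hc] at h2
    have h3 : (Pi.single i 1 - u c • Pi.single (ι c) 1 : Fin n → ℂ) = 0 := by
      refine eq_zero_of_sum_nodePoint_mul hρ.ne_one hX fun j => ?_
      have h4 := congrFun h2 j
      simp only [Pi.smul_apply, smul_eq_mul] at h4
      simp only [Pi.sub_apply, Pi.smul_apply, smul_eq_mul, mul_sub, Finset.sum_sub_distrib,
        Pi.single_apply, mul_ite, mul_one, mul_zero, Finset.sum_ite_eq', Finset.mem_univ, if_true]
      rw [nodePoint_comm ρ j i, nodePoint_comm ρ j (ι c), h4]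
      ring
    have h5 := congrFun h3 i
    simp [Ne.symm hne] at h5
  -- The node matrix is used twice: on the gradient, to make each power `(ℓ_i·z)^{nk-1}` vanish, and
  -- then on the equations `ℓ_i·z = 0`.
  refine eq_zero_of_sum_nodePoint_mul hρ.ne_one hX fun i => ?_
  have h1 := congrFun (eq_zero_of_sum_nodePoint_mul hρ.ne_one hX hgrad) i
  by_contra hne
  exact mul_ne_zero (Nat.cast_ne_zero.2 (hfiber i)) (mul_ne_zero hρ0 (pow_ne_zero _ hne)) h1

theorem exists_nonsingular_pencilDual (hw : IsPrimitiveRoot w (k + 1)) (hn : 2 ≤ n) (hk : 0 < k)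
    {ρ : ℂ} (hρ : IsNearestRoot ρ (k + 1)) (hX : (n : ℂ) - 1 + ρ ≠ 0) :
    ∃ t : ℂ, (∀ c : Fin n → Fin (k + 1), 1 - eval (gridPoint w c) (sumPowForm n k t) ≠ 0) ∧
      ∀ z : Fin n → ℂ, (∀ j, eval z (pderiv j (pencilDual n k w t)) = 0) → z = 0 := by
  classical
  set s := ((n : ℂ) - 1 + ρ) ^ (k + 1) with hs
  have hs0 : s ≠ 0 := pow_ne_zero _ hX
  -- The weights of `pencilDual` multiplied by `1 - t * s`, with the factor cancelled where it can
  -- be, so that they extend continuously to `t = s⁻¹`.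
  let b : ℂ → (Fin n → Fin (k + 1)) → ℂ := fun t c => (∏ i, gridPoint w c i) *
    if (∑ i, gridPoint w c i) ^ (k + 1) = s then 1
    else (1 - t * s) * (1 - t * (∑ i, gridPoint w c i) ^ (k + 1))⁻¹
  have hne : ∀ c : Fin n → Fin (k + 1), (∑ i, gridPoint w c i) ^ (k + 1) ≠ s →
      1 - s⁻¹ * (∑ i, gridPoint w c i) ^ (k + 1) ≠ 0 := by
    intro c hc h
    apply hc
    field_simp at h
    linear_combination -h
  have hb0 : b s⁻¹ = fun c => (∏ i, gridPoint w c i) *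
      if (∑ i, gridPoint w c i) ^ (k + 1) = s then 1 else 0 := by
    ext c
    simp only [b, inv_mul_cancel₀ hs0, sub_self, zero_mul]
  have hcont : ContinuousAt b s⁻¹ := by
    refine continuousAt_pi.2 fun c => ContinuousAt.mul continuousAt_const ?_
    split_ifs with h
    · exact continuousAt_const
    · refine ContinuousAt.mul (by fun_prop) (ContinuousAt.inv₀ (by fun_prop) (hne c h))
  have hns : ∀ᶠ t in 𝓝 s⁻¹, ∀ z : Fin n → ℂ, (∀ j, eval z (pderiv j (powerSum (n * k)
      (fun c : Fin n → Fin (k + 1) => gridPoint w c) (b t))) = 0) → z = 0 := by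
    refine hcont.eventually (eventually_powerSum_nonsingular ?_)
    rw [hb0]
    exact nonsingular_powerSum_node hw hn hk hρ hX
  have hgood : ∀ᶠ t in 𝓝[≠] s⁻¹, ∀ c : Fin n → Fin (k + 1),
      1 - t * (∑ i, gridPoint w c i) ^ (k + 1) ≠ 0 := by
    refine eventually_all.2 fun c => ?_
    by_cases hc : (∑ i, gridPoint w c i) ^ (k + 1) = s
    · filter_upwards [self_mem_nhdsWithin] with t ht h
      rw [hc] at h
      exact ht (eq_inv_of_mul_eq_one_left (sub_eq_zero.1 h).symm)
    · have h1 : ContinuousAt (fun t => 1 - t * (∑ i, gridPoint w c i) ^ (k + 1)) s⁻¹ := by fun_prop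
      exact (h1.eventually_ne (hne c hc)).filter_mono nhdsWithin_le_nhds
  obtain ⟨t, ⟨ht1, ht2⟩, hts⟩ :=
    ((hgood.and (hns.filter_mono nhdsWithin_le_nhds)).and self_mem_nhdsWithin).exists
  have hts' : 1 - t * s ≠ 0 := fun h => hts (eq_inv_of_mul_eq_one_left (sub_eq_zero.1 h).symm)
  refine ⟨t, fun c => by rw [eval_sumPowForm]; exact ht1 c, fun z hz => ht2 z fun j => ?_⟩
  have hbt : b t = fun c => (1 - t * s) * ((∏ i, gridPoint w c i) *
      (1 - eval (gridPoint w c) (sumPowForm n k t))⁻¹) := by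
    ext c
    simp only [b, eval_sumPowForm]
    split_ifs with h
    · rw [h]
      field_simp
    · ring
  have h1 := hz j
  rw [pencilDual, eval_pderiv_powerSum] at h1
  rw [eval_pderiv_powerSum, hbt]
  simp only [mul_assoc, ← Finset.mul_sum] at h1 ⊢
  rw [mul_left_comm, h1, mul_zero]

theorem nonsingular_pencilDual_two_one (hw : IsPrimitiveRoot w 2) (z : Fin 2 → ℂ)
    (hz : ∀ j, eval z (pderiv j (pencilDual 2 1 w 0)) = 0) : z = 0 := by
  have hw1 : w = -1 := hw.eq_neg_one_of_two_right
  have key : ∀ g : (Fin 2 → Fin 2) → ℂ, ∑ c, g c = g ![0, 0] + g ![0, 1] + (g ![1, 0] + g ![1, 1]) :=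
    fun g => by
      rw [← (finTwoArrowEquiv (Fin 2)).symm.sum_comp, Fintype.sum_prod_type]
      simp [Fin.sum_univ_two, finTwoArrowEquiv]
  have h0 := hz 0
  have h1 := hz 1
  simp only [pencilDual, eval_pderiv_powerSum, eval_sumPowForm] at h0 h1
  rw [key] at h0 h1
  simp [gridPoint, Fin.sum_univ_two, Fin.prod_univ_two, hw1] at h0 h1
  ext i
  fin_cases i
  · change z 0 = 0
    linear_combination h1 / 4
  · change z 1 = 0
    linear_combination h0 / 4

end Degeneration

/-- As `|ρ| = 1`, the equation forces `n = 2` and `ρ = -1`. If `-1` is nearest to `1`, it is the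
only root other than `1`, so the primitive root `w` is `-1` and `k + 1` divides `2`. -/
theorem two_one_of_sub_one_add_eq_zero {n k : ℕ} (hn : 2 ≤ n) (hk : 0 < k) {ρ w : ℂ}
    (hw : IsPrimitiveRoot w (k + 1)) (hρ : IsNearestRoot ρ (k + 1))
    (hX : (n : ℂ) - 1 + ρ = 0) : n = 2 ∧ k = 1 := by
  have h1 := congrArg Complex.re hX
  simp at h1
  have h2 := normSq_eq_one_of_pow_eq_one k.succ_ne_zero hρ.pow_eq_one
  have hn' : (2 : ℝ) ≤ n := by exact_mod_cast hn
  have hn2 : n = 2 := by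
    have : (n : ℝ) ≤ 2 := by nlinarith [sq_nonneg ρ.im]
    have : n ≤ 2 := by exact_mod_cast this
    omega
  refine ⟨hn2, ?_⟩
  subst hn2
  push_cast at h1
  have hρre : ρ.re = -1 := by linarith
  have h3 := normSq_eq_one_of_pow_eq_one k.succ_ne_zero hw.pow_eq_one
  have h4 := hρ.re_le w hw.pow_eq_one (hw.ne_one (by omega))
  have h5 : w.re = -1 := by nlinarith [sq_nonneg w.im]
  have h6 : w.im = 0 := by
    rw [h5] at h3
    nlinarith [sq_nonneg w.im]
  have h7 : w = -1 := Complex.ext (by simpa using h5) (by simpa using h6)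
  have h8 : w ^ 2 = 1 := by
    rw [h7]
    norm_num
  have := Nat.le_of_dvd (by norm_num) ((hw.pow_eq_one_iff_dvd 2).1 h8)
  omega

end

end AssocForm

theorem proposition3p3 (n m : ℕ) (hn : 2 ≤ n) (hm : 3 ≤ m) :
    ∃ Q ∈ AssocForm.nondegenerateForms n m, ∃ R : MvPolynomial (Fin n) ℂ,
      AssocForm.IsAssociatedForm m Q R ∧
        AssocForm.discriminant n (n * (m - 2)) R ≠ 0 := by
  obtain ⟨k, rfl⟩ := Nat.exists_eq_add_of_le' (by omega : 2 ≤ m)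
  have hk : 0 < k := by omega
  have hw := Complex.isPrimitiveRoot_exp (k + 1) k.succ_ne_zero
  obtain ⟨ρ, hρ⟩ := AssocForm.exists_isNearestRoot (e := k + 1) (by omega)
  by_cases hX : (n : ℂ) - 1 + ρ = 0
  · obtain ⟨rfl, rfl⟩ := AssocForm.two_one_of_sub_one_add_eq_zero hn hk hw hρ hX
    exact AssocForm.exists_pencilForm_of_nonsingular (t := 0) hw (by omega) hk
      (fun c => by simp [AssocForm.eval_sumPowForm])
      (AssocForm.nonsingular_pencilDual_two_one hw)
  · obtain ⟨t, ht, hR⟩ := AssocForm.exists_nonsingular_pencilDual hw hn hk hρ hX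
    exact AssocForm.exists_pencilForm_of_nonsingular hw (by omega) hk ht hR
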